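/- Fix a schema $\mathbf S$ (finitely many relation symbols, of arities $\geq 0$) and $k\geq 0$. Instances are finite sets of facts over an infinite domain of values; a ($k$-ary) pointed $\mathbf S$-instance $(I,\mathbf a)$ is an $\mathbf S$-instance $I$ with a $k$-tuple $\mathbf a$ of elements of its active domain, and homomorphisms of pointed instances preserve facts and the distinguished tuple. An instance is acyclic if its incidence multigraph (nodes: elements and facts; one edge for every occurrence of an element in a fact) has no cycles; it need not be connected. For a set $X$ of pointed instances, $X{\uparrow}=\{A\mid B\to A \text{ for some } B\in X\}$ and $X{\downarrow}=\{A\mid A\to B\text{ for some }B\in X\}$; $(F,D)$ is a homomorphism duality if $F{\uparrow}$ is the complement of $D{\downarrow}$ among the $k$-ary pointed $\mathbf S$-instances. A Datalog program $P$ with input schema $\mathbf S$ consists of mutually disjoint schemas $\mathbf S$, $\mathbf S_{out}$, $\mathbf S_{aux}$ and a finite set of rules $R_0(\mathbf x_0)\,{:}{-}\,R_1(\mathbf x_1),\dots,R_n(\mathbf x_n)$, $n\geq 0$, with $R_0\in \mathbf S_{out}\cup\mathbf S_{aux}$, $R_1,\dots,R_n\in\mathbf S\cup\mathbf S_{aux}$,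 and every variable of $\mathbf x_0$ occurring among $\mathbf x_1,\dots,\mathbf x_n$. The canonical instance of a rule has the conjuncts of the body as its facts and $\mathbf x_0$ as its distinguished tuple. The derivable rules of $P$ form the smallest set of rules containing the rules of $P$ and closed under substituting occurrences of rule heads by the corresponding rule bodies (renaming and unifying variables as necessary); for $R\in\mathbf S_{out}$, $\operatorname{Unfoldings}(P,R)$ is the set of canonical instances of the derivable rules with $R$ in the head and only $\mathbf S$-relations in the body. $P$ is a TAM Datalog program if (i) it is tree-shaped: the canonical instance of each rule is acyclic; and (ii) it is almost monadic: there is a partial function assigning to relations $T\in\mathbf S_{aux}$ an articulation position in $\{1,\dots,\mathrm{arity}(T)\}$ such that, in every rule, each variable occurring in a non-articulation position of an auxiliary relation in the body occurs only once in the body and does not occur in the articulation position of an auxiliary relation in the head. Let $F$ be any (possibly infinite) set of acyclic $k$-ary pointed $\mathbf S$-instances. Then the following are equivalent: 1. There is a finite set $D$ of $k$-ary pointed $\mathbf S$-instances such that $(F,D)$ is a homomorphism duality. 2. $F{\uparrow}=\operatorname{Unfoldings}(P,R){\uparrow}$ for some TAM Datalog program $P$ with input schema $\mathbf S$ and some $k$-ary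 output relation $R$ of $P$. -/

import Mathlib

namespace TAMDatalog

universe u

/-- A schema: a finite collection of relation symbols with specified arities (arity `0` allowed). -/
structure Schema where
  Rel : Type
  finite : Finite Rel
  arity : Rel → ℕ

/-- The union of two disjoint schemas. -/
def Schema.union (S T : Schema) : Schema where
  Rel := S.Rel ⊕ T.Rel
  finite := by
    have := S.finite
    have := T.finite
    infer_instance
  arity := Sum.elim S.arity T.arity

/-- A fact (or atom) `R(a₁, …, aₙ)` over `S`, with values (or variables) in `V`. -/
structure Fact (S : Schema) (V : Type u) where
  rel : S.Rel
  args : Fin (S.arity rel) → V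

/-- Apply a function to the values of a fact. -/
def Fact.map {S : Schema} {V : Type u} (h : V → V) (f : Fact S V) : Fact S V where
  rel := f.rel
  args := h ∘ f.args

/-- An `S`-fact regarded as a fact over the larger schema `S ∪ T`. -/
def Fact.inl {S : Schema} (T : Schema) {V : Type u} (f : Fact S V) : Fact (S.union T) V where
  rel := Sum.inl f.rel
  args := f.args

/-- A finite `S`-instance: a finite set of facts. -/
structure Inst (S : Schema) (V : Type u) where
  facts : Set (Fact S V)
  finite : facts.Finite

/-- The active domain: all values occurring in facts. -/
def Inst.adom {S : Schema} {V : Type u} (I : Inst S V) : Set V :=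
  {v | ∃ f ∈ I.facts, v ∈ Set.range f.args}

/-- The simple graph underlying the incidence graph of an instance: elements and facts are nodes,
and an element is adjacent to the facts in which it occurs. (Elements outside the active domain
and facts outside the instance are isolated nodes.) -/
def Inst.incidenceGraph {S : Schema} {V : Type u} (I : Inst S V) :
    SimpleGraph (V ⊕ Fact S V) where
  Adj
    | Sum.inl v, Sum.inr f => f ∈ I.facts ∧ v ∈ Set.range f.args
    | Sum.inr f, Sum.inl v => f ∈ I.facts ∧ v ∈ Set.range f.args
    | _, _ => False
  symm := ⟨by rintro (v | f) (w | g) h <;> exact h⟩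
  loopless := ⟨by rintro (v | f) h <;> exact h⟩

/-- Acyclicity of the incidence multigraph, which has one edge between `a` and `f` for every
occurrence of `a` in `f`: there are no parallel edges (they would form a cycle of length two), i.e.
no element occurs twice in the same fact, and the underlying simple graph is acyclic. -/
def Inst.IsAcyclic {S : Schema} {V : Type u} (I : Inst S V) : Prop :=
  (∀ f ∈ I.facts, Function.Injective f.args) ∧ I.incidenceGraph.IsAcyclic

/-- A `k`-ary pointed instance: the distinguished elements belong to the active domain. -/
structure PointedInst (S : Schema) (V : Type u) (k : ℕ) extends Inst S V where
  pt : Fin k → V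
  pt_mem : ∀ i, pt i ∈ toInst.adom

/-- Existence of a homomorphism of pointed instances. Only the values of `h` on the active domain
of `A` matter, and these automatically lie in the active domain of `B`. -/
def PointedInst.HomTo {S : Schema} {V : Type u} {k : ℕ} (A B : PointedInst S V k) : Prop :=
  ∃ h : V → V, (∀ f ∈ A.facts, f.map h ∈ B.facts) ∧ ∀ i, h (A.pt i) = B.pt i

/-- `X↑`. -/
def up {S : Schema} {V : Type u} {k : ℕ} (X : Set (PointedInst S V k)) :
    Set (PointedInst S V k) :=
  {A | ∃ B ∈ X, B.HomTo A}

/-- `X↓`. -/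
def down {S : Schema} {V : Type u} {k : ℕ} (X : Set (PointedInst S V k)) :
    Set (PointedInst S V k) :=
  {A | ∃ B ∈ X, A.HomTo B}

/-- `(F, D)` is a homomorphism duality. -/
def IsHomDuality {S : Schema} {V : Type u} {k : ℕ} (F D : Set (PointedInst S V k)) : Prop :=
  up F = (down D)ᶜ

/-- A Datalog rule `R₀(x₀) :- R₁(x₁), …, Rₙ(xₙ)` (`n ≥ 0`) with variables in `V`: the head uses an
output or auxiliary relation, the body uses input and auxiliary relations, and every variable of
the head occurs in the body. -/
structure Rule (Sin Sout Saux : Schema) (V : Type u) where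
  head : Fact (Sout.union Saux) V
  body : List (Fact (Sin.union Saux) V)
  safe : ∀ i, ∃ f ∈ body, head.args i ∈ Set.range f.args

section Rule

variable {Sin Sout Saux : Schema} {V : Type u}

/-- The canonical instance of a rule: the facts are the conjuncts of the body, the distinguished
elements are the arguments of the head. -/
def Rule.canonicalInst (r : Rule Sin Sout Saux V) :
    PointedInst (Sin.union Saux) V ((Sout.union Saux).arity r.head.rel) where
  facts := {f | f ∈ r.body}
  finite := List.finite_toSet r.body
  pt := r.head.args
  pt_mem := r.safe

/-- The variables of a rule. -/
def Rule.vars (r : Rule Sin Sout Saux V) : Set V :=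
  {v | ∃ f ∈ r.body, v ∈ Set.range f.args}

/-- The argument places of the body of a rule. -/
def Rule.Pos (r : Rule Sin Sout Saux V) : Type :=
  Σ j : Fin r.body.length, Fin ((Sin.union Saux).arity (r.body.get j).rel)

/-- The variable at a given argument place of the body. -/
def Rule.varAt (r : Rule Sin Sout Saux V) (p : r.Pos) : V :=
  (r.body.get p.1).args p.2

/-- `(σ, τ)` is a most general unifier of an atom `T(y)` in `r` with the head `T(x)` of a copy of
`s` whose variables have been renamed apart from those of `r`; here `σ` is applied to the variables
of `r`, and `τ` (which includes the renaming) to the variables of `s`. -/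
def IsMGU (r s : Rule Sin Sout Saux V) {n : ℕ} (y x : Fin n → V) (σ τ : V → V) : Prop :=
  σ ∘ y = τ ∘ x ∧
    ∀ σ' τ' : V → V, σ' ∘ y = τ' ∘ x →
      ∃ ρ : V → V, (∀ v ∈ r.vars, ρ (σ v) = σ' v) ∧ (∀ v ∈ s.vars, ρ (τ v) = τ' v)

/-- `t` results from `r` by substituting one occurrence of the head of `s` in the body of `r` by
the body of `s`, renaming and unifying variables as necessary. -/
def IsSubst (r s t : Rule Sin Sout Saux V) : Prop :=
  ∃ (pre post : List (Fact (Sin.union Saux) V)) (T : Saux.Rel) (y x : Fin (Saux.arity T) → V)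
    (σ τ : V → V),
    r.body = pre ++ [⟨Sum.inr T, y⟩] ++ post ∧
    s.head = ⟨Sum.inr T, x⟩ ∧
    IsMGU r s y x σ τ ∧
    t.head = r.head.map σ ∧
    t.body = pre.map (Fact.map σ) ++ s.body.map (Fact.map τ) ++ post.map (Fact.map σ)

end Rule

/-- A Datalog program with input schema `Sin` and variables in `V`: an output schema, an auxiliary
schema, and a finite set of rules. -/
structure Program (Sin : Schema) (V : Type u) where
  out : Schema
  aux : Schema
  rules : Set (Rule Sin out aux V)
  finite : rules.Finite

section Program

variable {Sin : Schema} {V : Type u}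

/-- The derivable rules: the smallest set of rules that contains the rules of the program and is
closed under substituting occurrences of rule heads by the corresponding rule bodies. -/
inductive Program.Derivable (P : Program Sin V) : Rule Sin P.out P.aux V → Prop
  | base (r : Rule Sin P.out P.aux V) : r ∈ P.rules → P.Derivable r
  | subst (r s t : Rule Sin P.out P.aux V) :
      P.Derivable r → P.Derivable s → IsSubst r s t → P.Derivable t

/-- `Unfoldings(P, R)`: the canonical instances of the derivable rules that have `R` in the head
and only input relations in the body. -/
def Program.unfoldings (P : Program Sin V) (R : P.out.Rel) :
    Set (PointedInst Sin V (P.out.arity R)) :=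
  {A | ∃ r, P.Derivable r ∧ r.head = ⟨Sum.inl R, A.pt⟩ ∧
    r.canonicalInst.facts = Fact.inl P.aux '' A.facts}

/-- A program is tree-shaped if the incidence graph of each of its rules is acyclic. -/
def Program.IsTreeShaped (P : Program Sin V) : Prop :=
  ∀ r ∈ P.rules, r.canonicalInst.IsAcyclic

/-- Position `i` of the relation `R` is the articulation position of an auxiliary relation, where
`f` is a partial function that picks an articulation position for auxiliary relations. -/
def IsArticulation {S Saux : Schema} (f : (T : Saux.Rel) → Option (Fin (Saux.arity T))) :
    (R : (S.union Saux).Rel) → Fin ((S.union Saux).arity R) → Prop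
  | Sum.inl _, _ => False
  | Sum.inr T, i => f T = some i

/-- Position `i` of the relation `R` is a non-articulation position of an auxiliary relation. -/
def IsNonArticulation {S Saux : Schema} (f : (T : Saux.Rel) → Option (Fin (Saux.arity T))) :
    (R : (S.union Saux).Rel) → Fin ((S.union Saux).arity R) → Prop
  | Sum.inl _, _ => False
  | Sum.inr T, i => f T ≠ some i

/-- A program is almost monadic if, for some articulation function, in every rule, each variable
occurring in a non-articulation position of an auxiliary relation in the body occurs only once in
the body, and does not occur in the articulation position of an auxiliary relation in the head. -/
def Program.IsAlmostMonadic (P : Program Sin V) : Prop :=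
  ∃ f : (T : P.aux.Rel) → Option (Fin (P.aux.arity T)),
    ∀ r ∈ P.rules, ∀ p : r.Pos, IsNonArticulation f (r.body.get p.1).rel p.2 →
      (∀ q : r.Pos, r.varAt q = r.varAt p → q = p) ∧
      ∀ i, IsArticulation f r.head.rel i → r.head.args i ≠ r.varAt p

/-- TAM Datalog programs: tree-shaped, almost-monadic Datalog programs. -/
def Program.IsTAM (P : Program Sin V) : Prop :=
  P.IsTreeShaped ∧ P.IsAlmostMonadic

end Program

end TAMDatalog

namespace TAMDatalog
universe u

/-! Both directions replace unfoldings by least fixpoints: by `Program.mem_up_unfoldings_iff`, an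
instance lies above an unfolding for `R` exactly when `R` holds of its distinguished tuple in every
set of facts closed under the rules.

From a program to finitely many duals: call two elements equivalent if they realise the same partial
rule bodies, with prescribed distinguished values, and fill the same distinguished positions. There
are finitely many such types. If `R` fails at `A.pt`, it still fails in the quotient of `A` by types
(`Program.quotient_not_holds`). The reason is that a rule body satisfied in the quotient can be
lifted back to `A` fact by fact: tree shape lets partial lifts be glued at shared variables,
equality of types lets the values there be adjusted, and almost monadicity ensures that
non-articulation positions never have to be glued (`exists_lift`). So the instances over a fixed
finite set of type names in which `R` fails form a dual.

From finitely many duals to a program: an auxiliary relation is named by a family of `(k + 1)`-ary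
relations, one on each target instance. It records all images of a root and a tuple under
homomorphisms from part of the input. The program consists of all rules of a few tree shapes that
are valid in every target under this reading. Validity shows that no accepted instance maps to a
target (`canonicalProgram_sound`). Conversely, on an acyclic instance the exact image relations can
be derived by decomposing along its facts (`homRel_mem`), so an acyclic instance mapping to no
target is accepted (`canonicalProgram_complete`). -/

/-! ### Least-fixpoint semantics and unfoldings. -/

theorem Fact.args_eq_of_mk_eq {S : Schema} {V : Type u} {R : S.Rel} {x y : Fin (S.arity R) → V}
    (h : (⟨R, x⟩ : Fact S V) = ⟨R, y⟩) : x = y := by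
  injection h

theorem Fact.map_comp {S : Schema} {V : Type u} (g h : V → V) (f : Fact S V) :
    (f.map h).map g = f.map (g ∘ h) := rfl

theorem Fact.map_congr {S : Schema} {V : Type u} {g h : V → V} {f : Fact S V}
    (H : ∀ v ∈ Set.range f.args, g v = h v) : f.map g = f.map h := by
  unfold Fact.map
  congr 1
  funext i
  exact H _ ⟨i, rfl⟩

theorem Fact.inl_injective {S : Schema} (T : Schema) {V : Type u} :
    Function.Injective (Fact.inl T : Fact S V → Fact (S.union T) V) := by
  rintro ⟨R, x⟩ ⟨R', x'⟩ h
  obtain rfl : R = R' := Sum.inl_injective (congrArg Fact.rel h)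
  exact congrArg (Fact.mk R) (Fact.args_eq_of_mk_eq (S := S.union T) (R := Sum.inl R) h)

/-- The facts of the structure given by the input facts `I` and, for the auxiliary relations, by
the facts in `M`. -/
def bodyModel {Sin Sout Saux : Schema} {V : Type u} (I : Set (Fact Sin V))
    (M : Set (Fact (Sout.union Saux) V)) : Set (Fact (Sin.union Saux) V) :=
  fun
  | ⟨Sum.inl R, x⟩ => (⟨R, x⟩ : Fact Sin V) ∈ I
  | ⟨Sum.inr T, x⟩ => (⟨Sum.inr T, x⟩ : Fact (Sout.union Saux) V) ∈ M

theorem bodyModel_mono {Sin Sout Saux : Schema} {V : Type u} {I : Set (Fact Sin V)}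
    {M M' : Set (Fact (Sout.union Saux) V)} (h : M ⊆ M') : bodyModel I M ⊆ bodyModel I M' := by
  rintro ⟨R | T, x⟩ hf
  · exact hf
  · exact h hf

/-- The set `M` of facts is closed under the rule `r`, over the input facts `I`. -/
def Rule.Sound {Sin Sout Saux : Schema} {V : Type u} (r : Rule Sin Sout Saux V)
    (I : Set (Fact Sin V)) (M : Set (Fact (Sout.union Saux) V)) : Prop :=
  ∀ g : V → V, (∀ f ∈ r.body, f.map g ∈ bodyModel I M) → r.head.map g ∈ M

/-- The least-fixpoint semantics of a Datalog program. -/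
def Program.Holds {Sin : Schema} {V : Type u} (P : Program Sin V) (I : Set (Fact Sin V)) :
    Set (Fact (P.out.union P.aux) V) :=
  {f | ∀ M : Set (Fact (P.out.union P.aux) V), (∀ r ∈ P.rules, r.Sound I M) → f ∈ M}

section

variable {Sin : Schema} {V : Type u} {P : Program Sin V}

theorem Program.sound_holds (I : Set (Fact Sin V)) {r : Rule Sin P.out P.aux V}
    (hr : r ∈ P.rules) : r.Sound I (P.Holds I) := by
  intro g hg M hM
  refine hM r hr g fun f hf => bodyModel_mono ?_ (hg f hf)
  intro f' hf'
  exact hf' M hM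

/-- The preimage under `h` of the fixpoint over `J` is closed under the rules over `I`. -/
theorem Program.Holds.map {I J : Set (Fact Sin V)} {h : V → V} (hIJ : ∀ f ∈ I, f.map h ∈ J)
    {f : Fact (P.out.union P.aux) V} (hf : f ∈ P.Holds I) : f.map h ∈ P.Holds J := by
  refine hf {f | f.map h ∈ P.Holds J} ?_
  intro r hr g hg
  refine P.sound_holds J hr (h ∘ g) fun f hf => ?_
  have := hg f hf
  obtain ⟨R | T, x⟩ := f
  · exact hIJ _ this
  · exact this

theorem Program.Derivable.sound {I : Set (Fact Sin V)} {M : Set (Fact (P.out.union P.aux) V)}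
    (hM : ∀ r ∈ P.rules, r.Sound I M) {r : Rule Sin P.out P.aux V} (hr : P.Derivable r) :
    r.Sound I M := by
  induction hr with
  | base r hr => exact hM r hr
  | subst r s t _ _ hsub ihr ihs =>
    obtain ⟨pre, post, T, y, x, σ, τ, hrb, hsh, ⟨hun, -⟩, hth, htb⟩ := hsub
    intro g hg
    rw [hth]
    rw [htb] at hg
    refine ihr (g ∘ σ) fun f hf => ?_
    rw [hrb] at hf
    simp only [List.mem_append, List.mem_singleton, List.mem_map] at hf hg
    rcases hf with (hf | rfl) | hf
    · exact hg _ (Or.inl (Or.inl ⟨f, hf, rfl⟩))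
    · have := ihs (g ∘ τ) fun f hf => hg _ (Or.inl (Or.inr ⟨f, hf, rfl⟩))
      rw [hsh] at this
      have e : (g ∘ τ) ∘ x = (g ∘ σ) ∘ y := by
        rw [Function.comp_assoc, ← hun, Function.comp_assoc]
      have e' := congrArg (fun z => (⟨Sum.inr T, z⟩ : Fact (P.out.union P.aux) V)) e
      have h2 : (⟨Sum.inr T, (g ∘ σ) ∘ y⟩ : Fact (P.out.union P.aux) V) ∈ M := e' ▸ this
      exact h2
    · exact hg _ (Or.inr ⟨f, hf, rfl⟩)

/-- The free solution is the quotient of two disjoint copies of the variables by the required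
identifications. As `V` is infinite, `V ⊕ V` is in bijection with `V`, so the quotient embeds in
`V`. -/
theorem exists_isMGU [Infinite V] {Sout Saux : Schema} (r s : Rule Sin Sout Saux V) {n : ℕ}
    (y x : Fin n → V) : ∃ σ τ : V → V, IsMGU r s y x σ τ := by
  let rel : V ⊕ V → V ⊕ V → Prop := fun a b => ∃ i, a = Sum.inl (y i) ∧ b = Sum.inr (x i)
  obtain ⟨ι⟩ : Nonempty (V ⊕ V ≃ V) := by
    rw [← Cardinal.eq, Cardinal.mk_sum, Cardinal.lift_id]
    exact Cardinal.add_eq_self (Cardinal.aleph0_le_mk V)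
  let e : Quot rel → V := fun q => ι q.out
  have he : Function.Injective e := ι.injective.comp fun a b h => by
    rw [← Quot.out_eq a, ← Quot.out_eq b]
    exact congrArg _ h
  refine ⟨fun v => e (Quot.mk _ (Sum.inl v)), fun v => e (Quot.mk _ (Sum.inr v)), ?_, ?_⟩
  · funext i
    exact congrArg e (Quot.sound ⟨i, rfl, rfl⟩)
  · intro σ' τ' h
    let φ : Quot rel → V := Quot.lift (Sum.elim σ' τ') (by
      rintro _ _ ⟨i, rfl, rfl⟩
      exact congrFun h i)
    have : Nonempty (Quot rel) := ⟨Quot.mk _ (Sum.inl (ι (Sum.inl (Classical.arbitrary V))))⟩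
    refine ⟨fun v => φ (Function.invFun e v), ?_, ?_⟩
    · intro v _
      exact congrArg φ (Function.leftInverse_invFun he (Quot.mk rel (Sum.inl v)))
    · intro v _
      exact congrArg φ (Function.leftInverse_invFun he (Quot.mk rel (Sum.inr v)))

/-- A rule whose body consists of input atoms only. -/
def Rule.InputOnly {Sout Saux : Schema} (r : Rule Sin Sout Saux V) : Prop :=
  ∀ f ∈ r.body, f.rel.isLeft

/-- The facts that result from evaluating unfoldings. -/
def Program.unfoldedFacts (P : Program Sin V) (I : Set (Fact Sin V)) :
    Set (Fact (P.out.union P.aux) V) :=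
  {F | ∃ t, P.Derivable t ∧ t.InputOnly ∧
    ∃ g : V → V, (∀ f ∈ t.body, f.map g ∈ bodyModel I (P.Holds I)) ∧ t.head.map g = F}

/-- Induction on the number of auxiliary atoms in the body. One such atom is resolved with an
input-only derivable rule that produces it; the most general unifier makes the two given assignments
factor through the new rule. -/
theorem Program.Derivable.map_head_mem_unfoldedFacts [Infinite V] (I : Set (Fact Sin V)) (n : ℕ) :
    ∀ (r : Rule Sin P.out P.aux V) (_ : P.Derivable r) (g : V → V)
      (_ : ∀ f ∈ r.body, f.map g ∈ bodyModel I (P.unfoldedFacts I))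
      (_ : r.body.countP (fun f => f.rel.isRight) = n), r.head.map g ∈ P.unfoldedFacts I := by
  induction n with
  | zero =>
    intro r hr g hg hn
    have hio : r.InputOnly := by
      intro f hf
      rw [List.countP_eq_zero] at hn
      have := hn f hf
      rcases hfr : f.rel with R | T
      · rfl
      · rw [hfr] at this
        simp at this
    refine ⟨r, hr, hio, g, fun f hf => ?_, rfl⟩
    have h1 := hio f hf
    have h2 := hg f hf
    obtain ⟨R | T, x⟩ := f
    · exact h2
    · simp at h1
  | succ n ih =>
    intro r hr g hg hn
    obtain ⟨f, hf, hfr⟩ : ∃ f ∈ r.body, f.rel.isRight = true := by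
      rw [← List.countP_pos_iff]
      omega
    obtain ⟨pre, post, hb⟩ := List.append_of_mem hf
    obtain ⟨R | T, y⟩ := f
    · simp at hfr
    have hfg := hg _ hf
    obtain ⟨s, hs, hsio, gs, hgs, hse⟩ := hfg
    obtain ⟨T', x, hsh⟩ : ∃ T' x, s.head = ⟨Sum.inr T', x⟩ := by
      have := congrArg Fact.rel hse
      rcases hh : s.head with ⟨R' | T', x⟩
      · rw [hh] at this
        simp [Fact.map] at this
      · exact ⟨T', x, rfl⟩
    rw [hsh] at hse
    obtain rfl : T' = T := Sum.inr_injective (congrArg Fact.rel hse)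
    have hxy : gs ∘ x = g ∘ y := Fact.args_eq_of_mk_eq hse
    have hb' : r.body = pre ++ [⟨Sum.inr T', y⟩] ++ post := by simp [hb]
    obtain ⟨σ, τ, hmgu⟩ := exists_isMGU r s y x
    obtain ⟨ρ, hρr, hρs⟩ := hmgu.2 g gs hxy.symm
    let t : Rule Sin P.out P.aux V :=
      { head := r.head.map σ
        body := pre.map (Fact.map σ) ++ s.body.map (Fact.map τ) ++ post.map (Fact.map σ)
        safe := by
          intro i
          obtain ⟨f, hf, j, hj⟩ := r.safe i
          rw [hb'] at hf
          simp only [List.mem_append, List.mem_singleton] at hf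
          rcases hf with (hf | rfl) | hf
          · refine ⟨f.map σ, List.mem_append.2 (Or.inl (List.mem_append.2 (Or.inl (List.mem_map_of_mem hf)))), j, ?_⟩
            exact congrArg σ hj
          · have hs := s.safe
            rw [hsh] at hs
            obtain ⟨f', hf', j', hj'⟩ := hs j
            refine ⟨f'.map τ, List.mem_append.2 (Or.inl (List.mem_append.2 (Or.inr (List.mem_map_of_mem hf')))), j', ?_⟩
            have h1 := congrFun hmgu.1 j
            calc τ (f'.args j') = τ (x j) := congrArg τ hj'
              _ = σ (y j) := h1.symm
              _ = σ (r.head.args i) := congrArg σ hj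
          · refine ⟨f.map σ, List.mem_append.2 (Or.inr (List.mem_map_of_mem hf)), j, ?_⟩
            exact congrArg σ hj }
    have ht : P.Derivable t :=
      .subst r s t hr hs ⟨pre, post, T', y, x, σ, τ, hb', hsh, hmgu, rfl, rfl⟩
    have hmapr : ∀ f ∈ r.body, (f.map σ).map ρ = f.map g := by
      intro f hf
      rw [Fact.map_comp]
      exact Fact.map_congr fun v hv => hρr v ⟨f, hf, hv⟩
    have hmaps : ∀ f ∈ s.body, (f.map τ).map ρ = f.map gs := by
      intro f hf
      rw [Fact.map_comp]
      exact Fact.map_congr fun v hv => hρs v ⟨f, hf, hv⟩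
    have hhead : t.head.map ρ = r.head.map g := by
      change (r.head.map σ).map ρ = _
      rw [Fact.map_comp]
      refine Fact.map_congr ?_
      rintro v ⟨i, rfl⟩
      exact hρr _ (r.safe i)
    rw [← hhead]
    -- One auxiliary atom disappears and the body of `s` contributes none, so the count drops by
    -- exactly one.
    refine ih t ht ρ ?_ ?_
    · intro f hf
      simp only [t, List.mem_append, List.mem_map] at hf
      rcases hf with (⟨f, hf, rfl⟩ | ⟨f, hf, rfl⟩) | ⟨f, hf, rfl⟩
      · have : f ∈ r.body := by rw [hb']; simp [hf]
        rw [hmapr f this]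
        exact hg f this
      · rw [hmaps f hf]
        have h1 := hsio f hf
        have h2 := hgs f hf
        obtain ⟨R | T, x⟩ := f
        · exact h2
        · simp at h1
      · have : f ∈ r.body := by rw [hb']; simp [hf]
        rw [hmapr f this]
        exact hg f this
    · rw [hb'] at hn
      have hzero : s.body.countP (fun f => f.rel.isRight) = 0 := by
        rw [List.countP_eq_zero]
        intro f hf
        have := hsio f hf
        rcases hfr : f.rel with R | T
        · simp
        · rw [hfr] at this
          simp at this
      have e1 : ∀ (l : List (Fact (Sin.union P.aux) V)) (φ : V → V),
          (l.map (Fact.map φ)).countP (fun f => f.rel.isRight) =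
            l.countP (fun f => f.rel.isRight) := by
        intro l φ
        rw [List.countP_map]
        rfl
      simp only [t, List.countP_append, e1, hzero]
      simp only [List.countP_append, List.countP_cons, List.countP_nil] at hn
      simp at hn
      omega

theorem Program.holds_subset_unfoldedFacts [Infinite V] (I : Set (Fact Sin V)) :
    P.Holds I ⊆ P.unfoldedFacts I := by
  intro f hf
  refine hf _ fun r hr g hg => ?_
  exact (Program.Derivable.base r hr).map_head_mem_unfoldedFacts I _ r g hg rfl

/-- Unfoldings compute the least-fixpoint semantics. -/
theorem Program.mem_up_unfoldings_iff [Infinite V] (R : P.out.Rel)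
    (A : PointedInst Sin V (P.out.arity R)) :
    A ∈ up (P.unfoldings R) ↔
      (⟨Sum.inl R, A.pt⟩ : Fact (P.out.union P.aux) V) ∈ P.Holds A.facts := by
  constructor
  · rintro ⟨B, ⟨r, hr, hhead, hbody⟩, h, hh, hpt⟩ M hM
    have h1 := hr.sound hM h (fun f hf => by
      have : f ∈ r.canonicalInst.facts := hf
      rw [hbody] at this
      obtain ⟨f', hf', rfl⟩ := this
      exact hh f' hf')
    rw [hhead] at h1
    have : h ∘ B.pt = A.pt := funext hpt
    rw [← this]
    exact h1
  · intro hA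
    obtain ⟨t, ht, hio, g, hg, hhead⟩ := P.holds_subset_unfoldedFacts _ hA
    obtain ⟨x, hx⟩ : ∃ x, t.head = ⟨Sum.inl R, x⟩ := by
      have := congrArg Fact.rel hhead
      rcases hh : t.head with ⟨R' | T', x⟩
      · rw [hh] at this
        obtain rfl : R' = R := Sum.inl_injective this
        exact ⟨x, rfl⟩
      · rw [hh] at this
        simp [Fact.map] at this
    have hsafe := t.safe
    rw [hx] at hsafe hhead
    have himg : t.canonicalInst.facts = Fact.inl P.aux '' (Fact.inl P.aux ⁻¹' {f | f ∈ t.body}) := by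
      rw [Set.image_preimage_eq_inter_range]
      ext f
      constructor
      · intro hf
        refine ⟨hf, ?_⟩
        have := hio f hf
        obtain ⟨R' | T', z⟩ := f
        · exact ⟨⟨R', z⟩, rfl⟩
        · simp at this
      · exact fun hf => hf.1
    let B : PointedInst Sin V (P.out.arity R) :=
      { facts := Fact.inl P.aux ⁻¹' {f | f ∈ t.body}
        finite := (List.finite_toSet t.body).preimage (Fact.inl_injective _).injOn
        pt := x
        pt_mem := by
          intro i
          obtain ⟨f, hf, hv⟩ := hsafe i
          have := hio f hf
          obtain ⟨R' | T', z⟩ := f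
          · exact ⟨⟨R', z⟩, hf, hv⟩
          · simp at this }
    refine ⟨B, ⟨t, ht, hx, himg⟩, g, fun f hf => hg _ hf, ?_⟩
    exact fun i => congrFun (Fact.args_eq_of_mk_eq hhead) i

end

/-! ### Acyclicity as colourings of the elements. -/

/-- A combinatorial form of acyclicity of a set of facts: when a fact is removed, its arguments
fall into different connected components. -/
def TreeLike {S : Schema} {V : Type u} (s : Set (Fact S V)) : Prop :=
  ∀ f ∈ s, ∃ κ : V → Option (Fin (S.arity f.rel)), (∀ i, κ (f.args i) = some i) ∧
    ∀ g ∈ s, g ≠ f → ∃ c, ∀ a, κ (g.args a) = c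

theorem TreeLike.mono {S : Schema} {V : Type u} {s t : Set (Fact S V)} (ht : TreeLike t)
    (hst : s ⊆ t) : TreeLike s := by
  intro f hf
  obtain ⟨κ, h1, h2⟩ := ht f (hst hf)
  exact ⟨κ, h1, fun g hg => h2 g (hst hg)⟩

/-- The colour of an element is the argument of `f` to which it is connected once the node `f` is
deleted. It is unique: two arguments connected outside `f` would give a path bypassing an edge at
`f`, which must be a bridge. -/
theorem Inst.IsAcyclic.treeLike {S : Schema} {V : Type u} {I : Inst S V} (h : I.IsAcyclic) :
    TreeLike I.facts := by
  classical
  obtain ⟨hinj, hac⟩ := h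
  intro f hf
  let G := I.incidenceGraph
  let H : SimpleGraph (V ⊕ Fact S V) := G.deleteIncidenceSet (Sum.inr f)
  have hHG : H ≤ G := G.deleteIncidenceSet_le _
  have hHadj : ∀ (g : Fact S V), g ∈ I.facts → g ≠ f → ∀ a,
      H.Adj (Sum.inl (g.args a)) (Sum.inr g) := by
    intro g hg hgf a
    rw [SimpleGraph.deleteIncidenceSet_adj]
    exact ⟨⟨hg, a, rfl⟩, by simp, by simpa using hgf⟩
  have hadj : ∀ i, G.Adj (Sum.inl (f.args i)) (Sum.inr f) := fun i => ⟨hf, i, rfl⟩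
  have hsep : ∀ i j, H.Reachable (Sum.inl (f.args i)) (Sum.inl (f.args j)) → i = j := by
    intro i j hij
    by_contra hne
    have hb := (SimpleGraph.isAcyclic_iff_forall_adj_isBridge.1 hac) (hadj i)
    rw [SimpleGraph.isBridge_iff] at hb
    apply hb
    have h1 : (G \ SimpleGraph.fromEdgeSet {s(Sum.inl (f.args i), Sum.inr f)}).Reachable
        (Sum.inl (f.args i)) (Sum.inl (f.args j)) := by
      refine hij.mono ?_
      intro a b hab
      rw [SimpleGraph.deleteIncidenceSet_adj] at hab
      rw [SimpleGraph.sdiff_adj, SimpleGraph.fromEdgeSet_adj]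
      refine ⟨hab.1, ?_⟩
      rintro ⟨h, -⟩
      rw [Set.mem_singleton_iff, Sym2.eq_iff] at h
      rcases h with ⟨-, h⟩ | ⟨h, -⟩
      · exact hab.2.2 h
      · exact hab.2.1 h
    refine h1.trans (SimpleGraph.Adj.reachable ?_)
    rw [SimpleGraph.sdiff_adj, SimpleGraph.fromEdgeSet_adj]
    refine ⟨hadj j, ?_⟩
    rintro ⟨h, -⟩
    rw [Set.mem_singleton_iff, Sym2.eq_iff] at h
    rcases h with ⟨h, -⟩ | ⟨h, -⟩
    · exact hne (hinj f hf (Sum.inl_injective h)).symm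
    · simp at h
  let κ : V → Option (Fin (S.arity f.rel)) := fun x =>
    if h : ∃ i, H.Reachable (Sum.inl (f.args i)) (Sum.inl x) then some h.choose else none
  have hκ : ∀ x i, H.Reachable (Sum.inl (f.args i)) (Sum.inl x) → κ x = some i := by
    intro x i h
    have h' : ∃ i, H.Reachable (Sum.inl (f.args i)) (Sum.inl x) := ⟨i, h⟩
    simp only [κ, dif_pos h']
    rw [hsep _ _ (h'.choose_spec.trans h.symm)]
  have hκ' : ∀ x y, H.Reachable (Sum.inl x) (Sum.inl y) → κ x = κ y := by
    intro x y hxy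
    by_cases hx : ∃ i, H.Reachable (Sum.inl (f.args i)) (Sum.inl x)
    · obtain ⟨i, hi⟩ := hx
      rw [hκ x i hi, hκ y i (hi.trans hxy)]
    · have hy : ¬ ∃ i, H.Reachable (Sum.inl (f.args i)) (Sum.inl y) := by
        rintro ⟨i, hi⟩
        exact hx ⟨i, hi.trans hxy.symm⟩
      simp only [κ, dif_neg hx, dif_neg hy]
  refine ⟨κ, fun i => hκ _ _ (SimpleGraph.Reachable.refl _), ?_⟩
  intro g hg hgf
  by_cases hne : Nonempty (Fin (S.arity g.rel))
  · obtain ⟨b⟩ := hne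
    refine ⟨κ (g.args b), fun a => hκ' _ _ ?_⟩
    exact (hHadj g hg hgf a).reachable.trans (hHadj g hg hgf b).reachable.symm
  · exact ⟨none, fun a => (hne ⟨a⟩).elim⟩

theorem TreeLike.isAcyclic {S : Schema} {V : Type u} {I : Inst S V} (h : TreeLike I.facts) :
    I.IsAcyclic := by
  classical
  refine ⟨?_, ?_⟩
  · intro f hf i j hij
    obtain ⟨κ, h1, -⟩ := h f hf
    have := h1 i
    rw [hij, h1 j] at this
    exact (Option.some_injective _ this).symm
  · have key : ∀ f ∈ I.facts, ∀ i, I.incidenceGraph.IsBridge s(Sum.inl (f.args i), Sum.inr f) := by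
      intro f hf i
      obtain ⟨κ, h1, h2⟩ := h f hf
      rw [SimpleGraph.isBridge_iff]
      -- The nodes of colour `i`, without `f` itself; only the edge between `f` and its `i`-th
      -- argument leaves this set, so that edge is a bridge.
      let side : V ⊕ Fact S V → Prop := fun
        | Sum.inl x => κ x = some i
        | Sum.inr g => g ≠ f ∧ ∃ a, κ (g.args a) = some i
      have hside : ∀ x g, I.incidenceGraph.Adj (Sum.inl x) (Sum.inr g) →
          s((Sum.inl x : V ⊕ Fact S V), Sum.inr g) ≠ s(Sum.inl (f.args i), Sum.inr f) →
          (side (Sum.inl x) ↔ side (Sum.inr g)) := by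
        rintro x g ⟨hg, a, rfl⟩ hne
        by_cases hgf : g = f
        · subst hgf
          have hai : a ≠ i := by
            rintro rfl
            exact hne rfl
          simp only [side, h1, ne_eq, not_true_eq_false, false_and, iff_false]
          exact fun h => hai (Option.some_injective _ h)
        · obtain ⟨c, hc⟩ := h2 g hg hgf
          simp only [side, hc, ne_eq, hgf, not_false_eq_true, true_and]
          exact ⟨fun h => ⟨a, h⟩, fun ⟨_, h⟩ => h⟩
      have hstep : ∀ a b, (I.incidenceGraph \
          SimpleGraph.fromEdgeSet {s(Sum.inl (f.args i), Sum.inr f)}).Adj a b →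
          (side a ↔ side b) := by
        intro a b hadj
        rw [SimpleGraph.sdiff_adj, SimpleGraph.fromEdgeSet_adj] at hadj
        obtain ⟨ha, hn⟩ := hadj
        have hne := fun h => hn ⟨h, ha.ne⟩
        rw [Set.mem_singleton_iff] at hne
        rcases a with x | g <;> rcases b with y | g'
        · exact ha.elim
        · exact hside x g' ha hne
        · refine (hside y g ha.symm ?_).symm
          rw [Sym2.eq_swap]
          exact hne
        · exact ha.elim
      have hinv : ∀ a b, (I.incidenceGraph \
          SimpleGraph.fromEdgeSet {s(Sum.inl (f.args i), Sum.inr f)}).Reachable a b →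
          (side a ↔ side b) := by
        rintro a b ⟨p⟩
        induction p with
        | nil => exact Iff.rfl
        | cons hadj _ ih =>
          exact (hstep _ _ hadj).trans ih
      intro hr
      have := (hinv _ _ hr).1 (h1 i)
      exact this.1 rfl
    rw [SimpleGraph.isAcyclic_iff_forall_adj_isBridge]
    rintro (x | g) (y | g') hadj
    · exact hadj.elim
    · obtain ⟨hg, a, rfl⟩ := hadj
      exact key _ hg a
    · obtain ⟨hg, a, rfl⟩ := hadj
      rw [Sym2.eq_swap]
      exact key _ hg a
    · exact hadj.elim

/-- Removing a fact `f` from an acyclic set of facts splits the others into the parts attached to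
the arguments of `f`, and a remainder. -/
theorem TreeLike.exists_coloring {S : Schema} {V : Type u} {s : Set (Fact S V)} (h : TreeLike s)
    {f : Fact S V} (hf : f ∈ s) :
    ∃ (κ : V → Option (Fin (S.arity f.rel))) (χ : Fact S V → Option (Fin (S.arity f.rel))),
      (∀ i, κ (f.args i) = some i) ∧ ∀ g ∈ s, g ≠ f → ∀ a, κ (g.args a) = χ g := by
  classical
  obtain ⟨κ, h1, h2⟩ := h f hf
  refine ⟨κ, fun g => if hg : g ∈ s ∧ g ≠ f then (h2 g hg.1 hg.2).choose else none, h1, ?_⟩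
  intro g hg hgf a
  have := (h2 g hg hgf).choose_spec a
  simp only [dif_pos (show g ∈ s ∧ g ≠ f from ⟨hg, hgf⟩), this]

/-! ### Gluing lifts of single facts along a tree. -/

section Lifting

variable {S : Schema} {V : Type u} {k : ℕ}

/-- `g` maps a variable to a distinguished element `pt j` whenever `h` maps it to the
image of `pt j` under `q`. -/
def RespectsPoints (pt : Fin k → V) (q h : V → V) (X : Set V) (g : V → V) : Prop :=
  ∀ w ∈ X, ∀ j, h w = q (pt j) → g w = pt j

theorem exists_respectsPoints {pt : Fin k → V} {q : V → V}
    (hpt : ∀ c j, q c = q (pt j) → c = pt j) (h : V → V) (X : Set V) :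
    ∃ g, RespectsPoints pt q h X g := by
  classical
  refine ⟨fun w => if hw : ∃ j, h w = q (pt j) then pt hw.choose else w, fun w _ j hj => ?_⟩
  have hw : ∃ j, h w = q (pt j) := ⟨j, hj⟩
  simp only [dif_pos hw]
  exact hpt _ _ (hw.choose_spec.symm.trans hj)

open Classical in
theorem RespectsPoints.update {pt : Fin k → V} {q h g : V → V} {X : Set V}
    (hg : RespectsPoints pt q h X g) {v c : V} (hc : ∀ j, h v = q (pt j) → c = pt j) :
    RespectsPoints pt q h X (Function.update g v c) := by
  intro w hw j hj
  by_cases hwv : w = v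
  · subst hwv
    rw [Function.update_self]
    exact hc j hj
  · rw [Function.update_of_ne hwv]
    exact hg w hw j hj

/-- Lifting along a map `q` that preserves the types of elements: an assignment `h` whose facts
lift individually (exactly so at the positions not in `NA`) lifts as a whole. -/
theorem exists_lift (NA : (R : S.Rel) → Fin (S.arity R) → Prop) {s : Finset (Fact S V)}
    (htree : TreeLike (s : Set (Fact S V)))
    (huniq : ∀ f ∈ s, ∀ i, NA f.rel i → ∀ g ∈ s, ∀ b, g.args b = f.args i → g = f)
    (N : Set (Fact S V)) (X : Set V) (hX : ∀ f ∈ s, ∀ i, f.args i ∈ X) (pt : Fin k → V)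
    (q h : V → V) (hpt : ∀ c j, q c = q (pt j) → c = pt j)
    (htype : ∀ s' ⊆ s, ∀ v ∈ X, ∀ c c', q c = q c' →
      (∃ g : V → V, g v = c ∧ (∀ f ∈ s', f.map g ∈ N) ∧ RespectsPoints pt q h X g) →
      ∃ g : V → V, g v = c' ∧ (∀ f ∈ s', f.map g ∈ N) ∧ RespectsPoints pt q h X g)
    (hlift : ∀ f ∈ s, ∃ x : Fin (S.arity f.rel) → V, (⟨f.rel, x⟩ : Fact S V) ∈ N ∧
      ∀ i, (¬ NA f.rel i → q (x i) = h (f.args i)) ∧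
        (NA f.rel i → ∀ j, h (f.args i) = q (pt j) → x i = pt j))
    (t : Finset (Fact S V)) (ht : t ⊆ s) :
    (∃ g : V → V, (∀ f ∈ t, f.map g ∈ N) ∧ RespectsPoints pt q h X g) ∧
    ∀ v ∈ X, ∀ c, q c = h v → (∀ f ∈ t, ∀ i, NA f.rel i → f.args i ≠ v) →
      ∃ g : V → V, g v = c ∧ (∀ f ∈ t, f.map g ∈ N) ∧ RespectsPoints pt q h X g := by
  classical
  induction t using Finset.strongInduction with
  | H t ih =>
  obtain ⟨base, hbase⟩ := exists_respectsPoints hpt h X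
  -- Here `u` consists of the pivot `f` and the parts hanging at its positions outside `NA`. These
  -- parts are lifted by induction so as to agree with `x` and are glued at `f`; the remainder of
  -- `t` shares no variable with `u`, so any solution on `u` extends to `t`.
  have core : ∀ f ∈ t, ∃ (u : Finset (Fact S V)) (x : Fin (S.arity f.rel) → V), u ⊆ t ∧
      (∀ i, ¬ NA f.rel i → q (x i) = h (f.args i)) ∧
      (∃ G : V → V, (∀ i, G (f.args i) = x i) ∧ (∀ g ∈ u, g.map G ∈ N) ∧
        RespectsPoints pt q h X G) ∧
      ∀ G : V → V, (∀ g ∈ u, g.map G ∈ N) → RespectsPoints pt q h X G →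
        ∃ H : V → V, (∀ i, H (f.args i) = G (f.args i)) ∧ (∀ g ∈ t, g.map H ∈ N) ∧
          RespectsPoints pt q h X H := by
    intro f hf
    obtain ⟨x, hxN, hx⟩ := hlift f (ht hf)
    obtain ⟨κ, χ, hκ, hχ⟩ := htree.exists_coloring (ht hf)
    have hparts : ∀ i, ∃ g : V → V, g (f.args i) = x i ∧ RespectsPoints pt q h X g ∧
        (¬ NA f.rel i → ∀ f' ∈ t, f' ≠ f → χ f' = some i → f'.map g ∈ N) := by
      intro i
      -- A variable in an `NA` position occurs in no other fact, so nothing is attached there and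
      -- its value can be set freely, subject only to the distinguished elements.
      by_cases hi : NA f.rel i
      · refine ⟨Function.update base (f.args i) (x i), Function.update_self _ _ _,
          hbase.update ((hx i).2 hi), fun h => (h hi).elim⟩
      · have hss : t.filter (fun f' => f' ≠ f ∧ χ f' = some i) ⊂ t :=
          Finset.filter_ssubset.2 ⟨f, hf, by simp⟩
        obtain ⟨g, hg1, hg2, hg3⟩ := (ih _ hss (hss.1.trans ht)).2 (f.args i) (hX f (ht hf) i)
          (x i) ((hx i).1 hi) (by
            intro f' hf' b hb hbi
            rw [Finset.mem_filter] at hf'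
            exact hf'.2.1 (huniq f' (ht hf'.1) b hb f (ht hf) i hbi.symm).symm)
        refine ⟨g, hg1, hg3, fun _ f' hf' hne hc => hg2 f' ?_⟩
        exact Finset.mem_filter.2 ⟨hf', hne, hc⟩
    choose gs hgs1 hgs2 hgs3 using hparts
    let good : Option (Fin (S.arity f.rel)) → Prop := fun c => ∃ i, c = some i ∧ ¬ NA f.rel i
    refine ⟨t.filter (fun f' => f' = f ∨ good (χ f')), x, Finset.filter_subset _ _,
      fun i => (hx i).1, ?_, ?_⟩
    · let G : V → V := fun w => ((κ w).map fun i => gs i w).getD (base w)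
      have hG : ∀ w i, κ w = some i → G w = gs i w := by
        intro w i hw
        simp [G, hw]
      refine ⟨G, fun i => (hG _ _ (hκ i)).trans (hgs1 i), ?_, ?_⟩
      · intro g hg
        rw [Finset.mem_filter] at hg
        obtain ⟨hgt, hg⟩ := hg
        by_cases hgf : g = f
        · subst hgf
          have : g.map G = ⟨g.rel, x⟩ :=
            congrArg (Fact.mk g.rel) (funext fun i => (hG _ _ (hκ i)).trans (hgs1 i))
          rw [this]
          exact hxN
        · obtain ⟨i, hc, hi⟩ := hg.resolve_left hgf
          have : g.map G = g.map (gs i) := by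
            refine Fact.map_congr ?_
            rintro v ⟨a, rfl⟩
            exact hG _ _ ((hχ g (ht hgt) hgf a).trans hc)
          rw [this]
          exact hgs3 i hi g hgt hgf hc
      · intro w hw j hj
        rcases hc : κ w with _ | i
        · simp only [G, hc, Option.map_none, Option.getD_none]
          exact hbase w hw j hj
        · rw [hG w i hc]
          exact hgs2 i w hw j hj
    · intro G hG1 hG2
      have hss : t.filter (fun f' => ¬ (f' = f ∨ good (χ f'))) ⊂ t :=
        Finset.filter_ssubset.2 ⟨f, hf, by simp⟩
      obtain ⟨G', hG'1, hG'2⟩ := (ih _ hss (hss.1.trans ht)).1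
      let H : V → V := fun w => if good (κ w) ∨ w ∈ Set.range f.args then G w else G' w
      refine ⟨H, fun i => ?_, ?_, ?_⟩
      · simp [H]
      · intro g hg
        by_cases hgf : g = f
        · subst hgf
          have : g.map H = g.map G := Fact.map_congr fun v hv => by simp only [H, if_pos (Or.inr hv)]
          rw [this]
          exact hG1 g (Finset.mem_filter.2 ⟨hg, Or.inl rfl⟩)
        · by_cases hgood : good (χ g)
          · have : g.map H = g.map G := by
              refine Fact.map_congr ?_
              rintro v ⟨a, rfl⟩
              have : good (κ (g.args a)) := (hχ g (ht hg) hgf a).symm ▸ hgood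
              simp only [H, if_pos (Or.inl this)]
            rw [this]
            exact hG1 g (Finset.mem_filter.2 ⟨hg, Or.inr hgood⟩)
          · have : g.map H = g.map G' := by
              refine Fact.map_congr ?_
              rintro v ⟨a, rfl⟩
              have h1 : ¬ good (κ (g.args a)) := (hχ g (ht hg) hgf a).symm ▸ hgood
              -- A fact of the remainder contains no argument of `f`: at an `NA` position by
              -- uniqueness, elsewhere because its colour would be good.
              have h2 : g.args a ∉ Set.range f.args := by
                rintro ⟨i, hi⟩
                by_cases hNA : NA f.rel i
                · exact hgf (huniq f (ht hf) i hNA g (ht hg) a hi.symm)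
                · refine h1 ⟨i, ?_, hNA⟩
                  rw [← hi]
                  exact hκ i
              have h3 : ¬ (good (κ (g.args a)) ∨ g.args a ∈ Set.range f.args) :=
                not_or.2 ⟨h1, h2⟩
              simp only [H, if_neg h3]
            rw [this]
            exact hG'1 g (Finset.mem_filter.2 ⟨hg, not_or.2 ⟨hgf, hgood⟩⟩)
      · intro w hw j hj
        simp only [H]
        split_ifs
        · exact hG2 w hw j hj
        · exact hG'2 w hw j hj
  have claim0 : ∃ g : V → V, (∀ f ∈ t, f.map g ∈ N) ∧ RespectsPoints pt q h X g := by
    rcases t.eq_empty_or_nonempty with rfl | ⟨f, hf⟩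
    · exact ⟨base, by simp, hbase⟩
    · obtain ⟨u, x, -, -, ⟨G, -, hG1, hG2⟩, hglue⟩ := core f hf
      obtain ⟨H, -, hH⟩ := hglue G hG1 hG2
      exact ⟨H, hH⟩
  refine ⟨claim0, ?_⟩
  intro v hv c hc hvt
  by_cases hvf : ∃ f ∈ t, v ∈ Set.range f.args
  · obtain ⟨f, hf, i, rfl⟩ := hvf
    obtain ⟨u, x, hut, hx, ⟨G, hG0, hG1, hG2⟩, hglue⟩ := core f hf
    have hi : ¬ NA f.rel i := fun hi => hvt f hf i hi rfl
    -- The lift of `f` forces the value `x i`, which need not be `c`; both have the same image under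
    -- `q`, and the type hypothesis allows the exchange.
    obtain ⟨G', hG'0, hG'1, hG'2⟩ := htype u (hut.trans ht) (f.args i) hv (x i) c
      ((hx i hi).trans hc.symm) ⟨G, hG0 i, hG1, hG2⟩
    obtain ⟨H, hH0, hH⟩ := hglue G' hG'1 hG'2
    exact ⟨H, (hH0 i).trans hG'0, hH⟩
  · obtain ⟨g, hg1, hg2⟩ := claim0
    refine ⟨Function.update g v c, Function.update_self _ _ _, ?_,
      hg2.update fun j hj => hpt _ _ (hc.trans hj)⟩
    intro f hf
    have : f.map (Function.update g v c) = f.map g := by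
      refine Fact.map_congr fun w hw => Function.update_of_ne ?_ _ _
      rintro rfl
      exact hvf ⟨f, hf, hw⟩
    rw [this]
    exact hg1 f hf

end Lifting

/-! ### Quotients by types do not create derivations. -/

section Quotient

variable {Sin : Schema} {V : Type u}

theorem Fact.ext_of_map {S : Schema} {f g : Fact S V} {h h' : V → V} (hfg : f.map h = g.map h') :
    ∃ x : Fin (S.arity g.rel) → V, (⟨g.rel, x⟩ : Fact S V) = f ∧ ∀ i, h (x i) = h' (g.args i) := by
  obtain ⟨R, x⟩ := f
  obtain ⟨R', y⟩ := g
  obtain rfl : R = R' := congrArg Fact.rel hfg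
  exact ⟨x, rfl, fun i => congrFun (Fact.args_eq_of_mk_eq hfg) i⟩

/-- The image of a pointed instance. -/
def PointedInst.image {S : Schema} {k : ℕ} (A : PointedInst S V k) (q : V → V) :
    PointedInst S V k where
  facts := Fact.map q '' A.facts
  finite := A.finite.image _
  pt := q ∘ A.pt
  pt_mem i := by
    obtain ⟨f, hf, a, ha⟩ := A.pt_mem i
    exact ⟨f.map q, ⟨f, hf, rfl⟩, a, congrArg q ha⟩

/-- The types of elements relative to a program: which subsets of rule bodies can be satisfied at
an element, and which distinguished positions it fills. -/
def Program.ElemType (P : Program Sin V) (k : ℕ) : Type u :=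
  Set (Σ r : P.rules, Set {f // f ∈ r.1.body} × r.1.vars × (r.1.vars → Set (Fin k))) × Set (Fin k)

theorem Rule.vars_finite {Sout Saux : Schema} (r : Rule Sin Sout Saux V) : r.vars.Finite := by
  have : r.vars = ⋃ f ∈ {f | f ∈ r.body}, Set.range f.args := by
    ext v
    simp [Rule.vars]
  rw [this]
  exact (List.finite_toSet r.body).biUnion fun f _ => Set.finite_range _

instance (P : Program Sin V) (k : ℕ) : Finite (P.ElemType k) := by
  have h1 : Finite P.rules := P.finite.to_subtype
  have h2 : ∀ r : P.rules, Finite r.1.vars := fun r => r.1.vars_finite.to_subtype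
  have h3 : ∀ r : P.rules, Finite {f // f ∈ r.1.body} :=
    fun r => (List.finite_toSet r.1.body).to_subtype
  unfold Program.ElemType
  infer_instance

/-- The type of an element in a structure with facts `N` and distinguished elements `pt`. -/
def Program.elemType (P : Program Sin V) {k : ℕ} (N : Set (Fact (Sin.union P.aux) V))
    (pt : Fin k → V) (c : V) : P.ElemType k :=
  ({x | ∃ g : V → V, g x.2.2.1 = c ∧ (∀ f ∈ x.2.1, f.1.map g ∈ N) ∧
      ∀ w, ∀ j ∈ x.2.2.2 w, g w = pt j}, {j | c = pt j})

/-- The interpretation of the output and auxiliary relations in the quotient of a structure `M` in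
which `R(pt)` does not hold. -/
def quotientModel {Sout Saux : Schema} (fart : (T : Saux.Rel) → Option (Fin (Saux.arity T)))
    (R : Sout.Rel) (pt : Fin (Sout.arity R) → V) (M : Set (Fact (Sout.union Saux) V)) (q : V → V) :
    Set (Fact (Sout.union Saux) V) :=
  fun
  | ⟨Sum.inl R', y⟩ => (⟨R', y⟩ : Fact Sout V) ≠ ⟨R, q ∘ pt⟩
  | ⟨Sum.inr T, y⟩ => ∃ x : Fin (Saux.arity T) → V,
      (⟨Sum.inr T, x⟩ : Fact (Sout.union Saux) V) ∈ M ∧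
      ∀ i, (fart T = some i → q (x i) = y i) ∧
        (fart T ≠ some i → ∀ j, y i = q (pt j) → x i = pt j)

/-- It suffices that `quotientModel` is closed under the rules, since it omits `R(q ∘ pt)` by
definition. An auxiliary fact there needs a preimage that is exact only at the articulation
position; elsewhere it must merely recover distinguished elements. This weak requirement survives
lifting. -/
theorem Program.quotient_not_holds {P : Program Sin V} (hP : P.IsTAM) {R : P.out.Rel}
    {A : PointedInst Sin V (P.out.arity R)}
    (hA : (⟨Sum.inl R, A.pt⟩ : Fact (P.out.union P.aux) V) ∉ P.Holds A.facts) {q : V → V}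
    (hq : ∀ c c', q c = q c' →
      P.elemType (bodyModel A.facts (P.Holds A.facts)) A.pt c =
      P.elemType (bodyModel A.facts (P.Holds A.facts)) A.pt c') :
    (⟨Sum.inl R, (A.image q).pt⟩ : Fact (P.out.union P.aux) V) ∉ P.Holds (A.image q).facts := by
  classical
  obtain ⟨htree, fart, hart⟩ := hP
  let N := bodyModel A.facts (P.Holds A.facts)
  let NA : (R : (Sin.union P.aux).Rel) → Fin ((Sin.union P.aux).arity R) → Prop :=
    IsNonArticulation (S := Sin) fart
  intro hcon
  have hpt : ∀ c j, q c = q (A.pt j) → c = A.pt j := by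
    intro c j h
    have h1 := congrArg Prod.snd (hq _ _ h)
    have h2 : j ∈ {j' | A.pt j = A.pt j'} := rfl
    have h3 : j ∈ {j' | c = A.pt j'} := by
      have h4 : {j' | c = A.pt j'} = {j' | A.pt j = A.pt j'} := h1
      rw [h4]
      exact h2
    exact h3
  refine hcon (quotientModel fart R A.pt (P.Holds A.facts) q) ?_ rfl
  intro r hr h hh
  have hbody : ∀ f ∈ r.body, ∃ x : Fin ((Sin.union P.aux).arity f.rel) → V,
      (⟨f.rel, x⟩ : Fact _ V) ∈ N ∧ ∀ i, (¬ NA f.rel i → q (x i) = h (f.args i)) ∧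
        (NA f.rel i → ∀ j, h (f.args i) = q (A.pt j) → x i = A.pt j) := by
    intro f hf
    have := hh f hf
    obtain ⟨R' | T, y⟩ := f
    · obtain ⟨f', hf', hff⟩ := this
      obtain ⟨x, rfl, hx⟩ := Fact.ext_of_map (g := (⟨R', y⟩ : Fact Sin V)) (h' := h) hff
      exact ⟨x, hf', fun i => ⟨fun _ => hx i, fun h => h.elim⟩⟩
    · obtain ⟨x, hx1, hx2⟩ := this
      refine ⟨x, hx1, fun i => ⟨fun hi => (hx2 i).1 ?_, fun hi => (hx2 i).2 hi⟩⟩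
      exact not_not.1 hi
  have hmon : ∀ f ∈ r.body, ∀ i, NA f.rel i →
      (∀ g ∈ r.body, ∀ b, g.args b = f.args i → g = f) ∧
      ∀ j, IsArticulation fart r.head.rel j → r.head.args j ≠ f.args i := by
    intro f hf i hi
    obtain ⟨n, rfl⟩ := List.get_of_mem hf
    obtain ⟨h1, h2⟩ := hart r hr ⟨n, i⟩ hi
    refine ⟨?_, h2⟩
    intro g hg b hb
    obtain ⟨m, rfl⟩ := List.get_of_mem hg
    have := h1 ⟨m, b⟩ hb
    have hmn : m = n := congrArg Sigma.fst this
    rw [hmn]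
  have hlift := exists_lift (s := r.body.toFinset) (k := P.out.arity R) NA
    ((htree r hr).treeLike.mono fun f hf => List.mem_toFinset.1 hf)
    (fun f hf i hi g hg b hb => (hmon f (by simpa using hf) i hi).1 g (by simpa using hg) b hb)
    N r.vars (fun f hf i => ⟨f, by simpa using hf, i, rfl⟩) A.pt q h hpt (by
      rintro s' hs' v hv c c' hcc ⟨g, hg1, hg2, hg3⟩
      have h1 := congrArg Prod.fst (hq _ _ hcc)
      -- The entry of the type that asks for the facts `s'`, the variable `v` at the given element,
      -- and the distinguished values forced by `h`.
      let e : Σ r : P.rules, Set {f // f ∈ r.1.body} × r.1.vars ×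
          (r.1.vars → Set (Fin (P.out.arity R))) :=
        ⟨⟨r, hr⟩, {f | f.1 ∈ s'}, ⟨v, hv⟩, fun w => {j | h w = q (A.pt j)}⟩
      have h2 : e ∈ (P.elemType N A.pt c).1 :=
        ⟨g, hg1, fun f hf => hg2 f.1 hf, fun w j hj => hg3 w.1 w.2 j hj⟩
      have h3 : e ∈ (P.elemType N A.pt c').1 := by
        rw [← h1]
        exact h2
      obtain ⟨g', hg'1, hg'2, hg'3⟩ := h3
      refine ⟨g', hg'1, fun f hf => hg'2 ⟨f, ?_⟩ hf, fun w hw j hj => hg'3 ⟨w, hw⟩ j hj⟩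
      simpa using hs' hf)
    (fun f hf => hbody f (by simpa using hf)) r.body.toFinset (Finset.Subset.refl _)
  simp only [List.mem_toFinset] at hlift
  obtain ⟨hlift0, hlift1⟩ := hlift
  have hsound := P.sound_holds A.facts hr
  have hsafe : ∀ i, r.head.args i ∈ r.vars := r.safe
  -- The variable in the articulation position of the head avoids non-articulation positions of the
  -- body, so its value has a preimage under `q` that can be prescribed in the lift.
  have hartv : ∀ i, IsArticulation fart r.head.rel i →
      (∃ c, q c = h (r.head.args i)) ∧
      ∀ f ∈ r.body, ∀ j, NA f.rel j → f.args j ≠ r.head.args i := by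
    intro i hi
    have h2 : ∀ f ∈ r.body, ∀ j, NA f.rel j → f.args j ≠ r.head.args i :=
      fun f hf j hj h => (hmon f hf j hj).2 i hi h.symm
    obtain ⟨f, hf, b, hb⟩ := hsafe i
    obtain ⟨x, -, hx⟩ := hbody f hf
    refine ⟨⟨x b, ?_⟩, h2⟩
    rw [← hb]
    exact (hx b).1 fun hNA => h2 f hf b hNA hb
  obtain ⟨head, body, safe⟩ := r
  obtain ⟨R' | T, y⟩ := head
  · intro heq
    obtain ⟨g, hg1, hg2⟩ := hlift0
    have h1 := hsound g hg1
    obtain rfl : R' = R := congrArg Fact.rel heq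
    have hy : h ∘ y = q ∘ A.pt :=
      Fact.args_eq_of_mk_eq (S := P.out) heq
    -- A body deriving the omitted fact would lift to one deriving `R(pt)` in `A`, as the lift
    -- respects distinguished elements.
    have hy' : g ∘ y = A.pt := funext fun i => hg2 _ (hsafe i) i (congrFun hy i)
    apply hA
    rw [← hy']
    exact h1
  · have hfinish : ∀ g : V → V, (∀ f ∈ body, f.map g ∈ N) →
        RespectsPoints A.pt q h (Rule.vars ⟨⟨Sum.inr T, y⟩, body, safe⟩) g →
        (∀ i, fart T = some i → q (g (y i)) = h (y i)) →
        (⟨Sum.inr T, h ∘ y⟩ : Fact (P.out.union P.aux) V) ∈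
          quotientModel fart R A.pt (P.Holds A.facts) q := fun g hg1 hg2 hg3 =>
      ⟨g ∘ y, hsound g hg1, fun i => ⟨hg3 i, fun _ j hj => hg2 _ (hsafe i) j hj⟩⟩
    rcases hT : fart T with _ | i
    · obtain ⟨g, hg1, hg2⟩ := hlift0
      exact hfinish g hg1 hg2 fun i hi => by simp [hT] at hi
    · obtain ⟨⟨c, hc⟩, hi⟩ := hartv i hT
      obtain ⟨g, hg0, hg1, hg2⟩ := hlift1 (y i) (hsafe i) c hc hi
      refine hfinish g hg1 hg2 fun i' hi' => ?_
      obtain rfl : i = i' := Option.some_injective _ (hT.symm.trans hi')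
      exact (congrArg q hg0).trans hc

end Quotient

/-! ### Finitely many duals from finitely many types. -/

section Finiteness

variable {S : Schema} {V : Type u}

theorem finite_facts {W : Set V} (hW : W.Finite) :
    {f : Fact S V | ∀ i, f.args i ∈ W}.Finite := by
  have := S.finite
  have := hW.to_subtype
  refine (Set.finite_range fun x : Σ R : S.Rel, (Fin (S.arity R) → W) =>
    (⟨x.1, fun i => (x.2 i : V)⟩ : Fact S V)).subset ?_
  intro f hf
  exact ⟨⟨f.rel, fun i => ⟨f.args i, hf i⟩⟩, rfl⟩

theorem finite_pointedInst {k : ℕ} {W : Set V} (hW : W.Finite) :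
    {A : PointedInst S V k | ∀ f ∈ A.facts, ∀ i, f.args i ∈ W}.Finite := by
  have h1 : ({s | s ⊆ {f : Fact S V | ∀ i, f.args i ∈ W}} ×ˢ
      {p : Fin k → V | ∀ i, p i ∈ W}).Finite := by
    refine ((finite_facts hW).finite_subsets).prod ?_
    have := Set.Finite.pi' (ι := Fin k) (κ := fun _ => V) (t := fun _ => W) fun _ => hW
    exact this
  refine Set.Finite.of_finite_image (f := fun A : PointedInst S V k => (A.facts, A.pt))
    (h1.subset ?_) ?_
  · rintro _ ⟨A, hA, rfl⟩
    refine ⟨fun f hf => hA f hf, fun i => ?_⟩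
    obtain ⟨f, hf, a, ha⟩ := A.pt_mem i
    exact (congrArg (· ∈ W) ha).mp (hA f hf a)
  · rintro ⟨⟨s, _⟩, p, _⟩ _ ⟨⟨s', _⟩, p', _⟩ _ h
    obtain ⟨rfl, rfl⟩ := Prod.mk.inj h
    rfl

theorem PointedInst.HomTo.trans {k : ℕ} {A B C : PointedInst S V k} (h : A.HomTo B)
    (h' : B.HomTo C) : A.HomTo C := by
  obtain ⟨g, hg1, hg2⟩ := h
  obtain ⟨g', hg'1, hg'2⟩ := h'
  exact ⟨g' ∘ g, fun f hf => hg'1 _ (hg1 f hf), fun i => (congrArg g' (hg2 i)).trans (hg'2 i)⟩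

theorem up_closed {k : ℕ} {X : Set (PointedInst S V k)} {A B : PointedInst S V k} (hA : A ∈ up X)
    (h : A.HomTo B) : B ∈ up X := by
  obtain ⟨C, hC, hCA⟩ := hA
  exact ⟨C, hC, hCA.trans h⟩

/-- The unfoldings of a TAM program have a finite set of duals. -/
theorem Program.exists_finite_dual [Infinite V] {P : Program S V} (hP : P.IsTAM) (R : P.out.Rel) :
    ∃ D : Set (PointedInst S V (P.out.arity R)), D.Finite ∧ up (P.unfoldings R) = (down D)ᶜ := by
  obtain ⟨n, ⟨e⟩⟩ := Finite.exists_equiv_fin (P.ElemType (P.out.arity R))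
  let ι : P.ElemType (P.out.arity R) → V := fun t => Infinite.natEmbedding V (e t)
  have hι : Function.Injective ι :=
    (Infinite.natEmbedding V).injective.comp (Fin.val_injective.comp e.injective)
  refine ⟨{A | (∀ f ∈ A.facts, ∀ i, f.args i ∈ Set.range ι) ∧ A ∉ up (P.unfoldings R)},
    (finite_pointedInst (Set.finite_range ι)).subset fun A hA => hA.1, ?_⟩
  ext A
  constructor
  · rintro hA ⟨B, hB, hAB⟩
    exact hB.2 (up_closed hA hAB)
  · intro hA
    by_contra hcon
    apply hA
    rw [P.mem_up_unfoldings_iff] at hcon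
    -- Each element is sent to the name of its type, so the image of `A` lives on the finite set
    -- `Set.range ι`.
    let q : V → V := fun c => ι (P.elemType (bodyModel A.facts (P.Holds A.facts)) A.pt c)
    refine ⟨A.image q, ⟨?_, ?_⟩, q, fun f hf => ⟨f, hf, rfl⟩, fun i => rfl⟩
    · rintro _ ⟨f, -, rfl⟩ i
      exact ⟨_, rfl⟩
    · rw [P.mem_up_unfoldings_iff]
      exact P.quotient_not_holds hP hcon fun c c' h => hι h

end Finiteness

/-- Passes from list positions to an index set for the atoms. Positions are compared as natural
numbers since their types depend on the atom. -/
theorem Rule.body_varAt_injective_of_map {Sin Sout Saux : Schema} {V : Type u} {ι : Type*}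
    {NA : (R : (Sin.union Saux).Rel) → Fin ((Sin.union Saux).arity R) → Prop}
    (r : Rule Sin Sout Saux V) (L : List ι) (hL : L.Nodup) (G : ι → Fact (Sin.union Saux) V)
    (hbody : r.body = L.map G)
    (H : ∀ a i, NA (G a).rel i → ∀ b i', (G b).args i' = (G a).args i → b = a ∧ (i' : ℕ) = i)
    (p : r.Pos) (hp : NA (r.body.get p.1).rel p.2) (q : r.Pos) (hq : r.varAt q = r.varAt p) :
    q = p := by
  have key : ∀ (f g : Fact (Sin.union Saux) V) i i' a b, f = G a → g = G b → NA f.rel i →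
      g.args i' = f.args i → b = a ∧ (i' : ℕ) = i := by
    rintro f g i i' a b rfl rfl hi h
    exact H a i hi b i' h
  have hlen : ∀ j : Fin r.body.length, j.1 < L.length := by
    intro j
    have := j.2
    simpa [hbody] using this
  have hget : ∀ j : Fin r.body.length, r.body.get j = G (L.get ⟨j.1, hlen j⟩) := by
    intro j
    simp [hbody]
  obtain ⟨j, i⟩ := p
  obtain ⟨j', i'⟩ := q
  obtain ⟨h1, h2⟩ := key _ _ i i' _ _ (hget j) (hget j') hp hq
  have h3 := hL.injective_get h1
  have h4 : j' = j := by
    apply Fin.ext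
    simpa using h3
  subst h4
  have h5 : i' = i := Fin.ext h2
  rw [h5]

/-! ### The canonical program of a finite set of targets. -/

section Construction

/-- The output schema with one relation, of arity `k`. -/
abbrev singleOut (k : ℕ) : Schema := ⟨Unit, inferInstance, fun _ => k⟩

/-- The auxiliary relations are the tuples of `(k + 1)`-ary relations over `e` elements. -/
abbrev relAux (m e k : ℕ) : Schema :=
  ⟨Set (Fin m × (Fin (k + 1) → Fin e)), inferInstance, fun _ => k + 1⟩

variable {S : Schema} {V : Type u} {k m e : ℕ}

/-- Variables indexed by a component and, possibly, a distinguished position. -/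
noncomputable def stdVar (V : Type u) [Infinite V] {n : ℕ} (x : Option (Fin n) × Option (Fin k)) : V :=
  Infinite.natEmbedding V (Encodable.encode x)

theorem stdVar_injective [Infinite V] {n : ℕ} :
    Function.Injective (stdVar V : Option (Fin n) × Option (Fin k) → V) :=
  (Infinite.natEmbedding V).injective.comp Encodable.encode_injective

theorem exists_stdVar_eq [Infinite V] {n : ℕ} {β : Type*} (φ : Option (Fin n) × Option (Fin k) → β) :
    ∃ g : V → β, ∀ x, g (stdVar V x) = φ x :=
  ⟨φ ∘ Function.invFun (stdVar V), fun x =>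
    congrArg φ (Function.leftInverse_invFun stdVar_injective x)⟩

/-- The rule `T(xᵢ, xᵢ, …, xᵢ) :- R(x₁, …, xₙ)`. -/
noncomputable def initRule (V : Type u) [Infinite V]
    (p : Σ R : S.Rel, Fin (S.arity R) × (relAux m e k).Rel) :
    Rule S (singleOut k) (relAux m e k) V where
  head := ⟨Sum.inr p.2.2, fun _ => stdVar V (k := k) (some p.2.1, none)⟩
  body := [⟨Sum.inl p.1, fun i => stdVar V (k := k) (some i, none)⟩]
  safe _ := ⟨_, List.mem_singleton_self _, p.2.1, rfl⟩

/-- The atom `T(x, y₁, …, yₖ)` for the component `c`, with root in the component `c.or π`. -/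
noncomputable def stepAtom (V : Type u) [Infinite V] {n : ℕ} (π : Option (Fin n))
    (ρs : Option (Fin n) → (relAux m e k).Rel) (c : Option (Fin n)) :
    Fact (S.union (relAux m e k)) V :=
  ⟨Sum.inr (ρs c), Fin.cons (stdVar V (k := k) (c.or π, none)) fun j => stdVar V (c, some j)⟩

/-- The atoms of the body of `stepRule`. -/
noncomputable def stepAtoms (V : Type u) [Infinite V] (R : S.Rel) (π : Option (Fin (S.arity R)))
    (ρs : Option (Fin (S.arity R)) → (relAux m e k).Rel) :
    Option (Option (Fin (S.arity R))) → Fact (S.union (relAux m e k)) V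
  | none => ⟨Sum.inl R, fun i => stdVar V (k := k) (some i, none)⟩
  | some c => stepAtom V π ρs c

/-- The rule that combines a fact `R(x₁, …, xₙ)` with one component rooted at each `xᵢ`, and one
further component rooted at a new variable (or at some `xᵢ` as well). -/
noncomputable def stepRule (V : Type u) [Infinite V]
    (p : Σ R : S.Rel, Option (Fin (S.arity R)) × (Fin k → Option (Fin (S.arity R))) ×
      (Option (Fin (S.arity R)) → (relAux m e k).Rel) × (relAux m e k).Rel) :
    Rule S (singleOut k) (relAux m e k) V where
  head := ⟨Sum.inr p.2.2.2.2, Fin.cons (stdVar V (k := k) (p.2.1, none))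
    fun j => stdVar V (p.2.2.1 j, some j)⟩
  body := Finset.univ.toList.map (stepAtoms V p.1 p.2.1 p.2.2.2.1)
  safe := by
    refine Fin.cases ?_ fun j => ?_
    · exact ⟨stepAtom V p.2.1 p.2.2.2.1 none,
        List.mem_map.2 ⟨some none, Finset.mem_toList.2 (Finset.mem_univ _), rfl⟩,
        (0 : Fin (k + 1)), rfl⟩
    · exact ⟨stepAtom V p.2.1 p.2.2.2.1 (p.2.2.1 j),
        List.mem_map.2 ⟨some (p.2.2.1 j), Finset.mem_toList.2 (Finset.mem_univ _), rfl⟩,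
        j.succ, rfl⟩

/-- The rule `R(y₁, …, yₖ) :- T(x, y₁, …, yₖ)`. -/
noncomputable def outRule (S : Schema) (V : Type u) [Infinite V] (ρ : (relAux m e k).Rel) :
    Rule S (singleOut k) (relAux m e k) V where
  head := ⟨Sum.inl (), fun j => stdVar V (n := 0) (none, some j)⟩
  body := [stepAtom V (n := 0) none (fun _ => ρ) none]
  safe := fun j => ⟨_, List.mem_singleton_self _, Fin.succ j, rfl⟩

/-- A rule without variables, for `k = 0`. -/
noncomputable def nullaryRule (V : Type u) (hk : k = 0) (N : Finset {R : S.Rel // S.arity R = 0}) :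
    Rule S (singleOut k) (relAux m e k) V where
  head := ⟨Sum.inl (), fun j : Fin k => (j.cast hk).elim0⟩
  body := N.toList.map fun R => ⟨Sum.inl R.1, fun i => (Fin.cast R.2 i).elim0⟩
  safe := fun j : Fin k => (j.cast hk).elim0

/-- Local conditions for tree-shaped, almost monadic programs. -/
def Rule.IsTAM (r : Rule S (singleOut k) (relAux m e k) V) : Prop :=
  r.canonicalInst.IsAcyclic ∧
    ∀ p : r.Pos, IsNonArticulation (Saux := relAux m e k) (fun _ => some (0 : Fin (k + 1)))
        (r.body.get p.1).rel p.2 →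
      (∀ q : r.Pos, r.varAt q = r.varAt p → q = p) ∧
      ∀ i, IsArticulation (Saux := relAux m e k) (fun _ => some (0 : Fin (k + 1))) r.head.rel i →
        r.head.args i ≠ r.varAt p

theorem Rule.isTAM_of_isLeft {r : Rule S (singleOut k) (relAux m e k) V}
    (h : TreeLike {f | f ∈ r.body}) (hr : ∀ f ∈ r.body, f.rel.isLeft) : r.IsTAM := by
  refine ⟨TreeLike.isAcyclic h, fun p hp => ?_⟩
  have := hr _ (List.get_mem r.body p.1)
  rcases hR : (r.body.get p.1).rel with R | T
  · exfalso
    have key : ∀ (R' : (S.union (relAux m e k)).Rel) i, R' = Sum.inl R →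
        ¬ IsNonArticulation (Saux := relAux m e k) (fun _ => some (0 : Fin (k + 1))) R' i := by
      rintro R' i rfl h
      exact h
    exact key _ _ hR hp
  · rw [hR] at this
    simp at this

theorem initRule_isTAM [Infinite V] (p : Σ R : S.Rel, Fin (S.arity R) × (relAux m e k).Rel) :
    (initRule V p).IsTAM := by
  refine Rule.isTAM_of_isLeft ?_ ?_
  · intro f hf
    obtain rfl := List.mem_singleton.1 hf
    obtain ⟨κ, hκ⟩ := exists_stdVar_eq (V := V) (n := S.arity p.1) (k := k)
      (fun x => x.1)
    refine ⟨κ, fun i => hκ _, fun g hg hne => ?_⟩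
    exact (hne (List.mem_singleton.1 hg)).elim
  · intro f hf
    obtain rfl := List.mem_singleton.1 hf
    rfl

theorem nullaryRule_isTAM (hk : k = 0) (N : Finset {R : S.Rel // S.arity R = 0}) :
    (nullaryRule V hk N : Rule S (singleOut k) (relAux m e k) V).IsTAM := by
  refine Rule.isTAM_of_isLeft ?_ ?_
  · intro f hf
    obtain ⟨R, -, rfl⟩ := List.mem_map.1 hf
    refine ⟨fun _ => none, fun i => (Fin.cast R.2 i).elim0, fun g hg _ => ⟨none, fun _ => rfl⟩⟩
  · intro f hf
    obtain ⟨R, -, rfl⟩ := List.mem_map.1 hf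
    rfl

theorem not_isNonArticulation_zero (T : (relAux m e k).Rel) :
    ¬ IsNonArticulation (S := S) (Saux := relAux m e k) (fun _ => some (0 : Fin (k + 1)))
      (Sum.inr T) (0 : Fin (k + 1)) :=
  fun h => h rfl

theorem stepAtom_args_succ_ne_root [Infinite V] {n : ℕ} {c c' : Option (Fin n)} {j : Fin k} :
    stdVar V (c, some j) ≠ stdVar V (k := k) (c', none) := by
  intro h
  have := stdVar_injective h
  simp at this

theorem stdVar_some_inj [Infinite V] {n : ℕ} {c c' : Option (Fin n)} {j j' : Fin k}
    (h : stdVar V (c, some j) = stdVar V (c', some j')) : c = c' ∧ j = j' := by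
  simpa using stdVar_injective h

theorem stepRule_isTAM [Infinite V]
    (p : Σ R : S.Rel, Option (Fin (S.arity R)) × (Fin k → Option (Fin (S.arity R))) ×
      (Option (Fin (S.arity R)) → (relAux m e k).Rel) × (relAux m e k).Rel) :
    (stepRule V p).IsTAM := by
  classical
  obtain ⟨R, π, col, ρs, ρ⟩ := p
  have hmem : ∀ f ∈ (stepRule V ⟨R, π, col, ρs, ρ⟩).body, ∃ o, stepAtoms V R π ρs o = f := by
    intro f hf
    obtain ⟨o, -, rfl⟩ := List.mem_map.1 hf
    exact ⟨o, rfl⟩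
  refine ⟨TreeLike.isAcyclic ?_, ?_⟩
  · intro f hf
    obtain ⟨o, rfl⟩ := hmem f hf
    rcases o with _ | c
    -- Pivot on the input atom: all variables of component `c` lie on the side of the argument `c.or
    -- π` where it is rooted, if any.
    · obtain ⟨κ, hκ⟩ := exists_stdVar_eq (V := V) (n := S.arity R) (k := k)
        (fun x => x.1.or π)
      refine ⟨κ, fun i => hκ _, fun g hg hne => ?_⟩
      obtain ⟨o', rfl⟩ := hmem g hg
      rcases o' with _ | c'
      · exact (hne rfl).elim
      · refine ⟨c'.or π, ?_⟩
        refine Fin.cases ?_ fun j => ?_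
        · refine (hκ (c'.or π, none)).trans ?_
          cases c' <;> cases π <;> rfl
        · exact hκ (c', some j)
    -- Pivot on the auxiliary atom of component `c`: only its root can be shared, so everything but
    -- its own fresh variables gets the colour of position `0`.
    · obtain ⟨κ, hκ⟩ := exists_stdVar_eq (V := V) (n := S.arity R) (k := k)
        (fun x => if x.1 = c then some ((x.2.map Fin.succ).getD (0 : Fin (k + 1)))
          else some (0 : Fin (k + 1)))
      refine ⟨κ, ?_, fun g hg hne => ⟨some (0 : Fin (k + 1)), ?_⟩⟩
      · refine Fin.cases ?_ fun j => ?_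
        · refine (hκ (c.or π, none)).trans ?_
          simp
          rfl
        · refine (hκ (c, some j)).trans ?_
          simp
          rfl
      · obtain ⟨o', rfl⟩ := hmem g hg
        rcases o' with _ | c'
        · intro i
          refine (hκ (some i, none)).trans ?_
          simp
          rfl
        · have hcc : c' ≠ c := by
            rintro rfl
            exact hne rfl
          refine Fin.cases ?_ fun j => ?_
          · refine (hκ (c'.or π, none)).trans ?_
            simp
            rfl
          · refine (hκ (c', some j)).trans ?_
            simp [hcc]
            rfl
  · intro p hp
    refine ⟨Rule.body_varAt_injective_of_map _ _ (Finset.nodup_toList _) _ rfl ?_ p hp, ?_⟩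
    · rintro (_ | c) i hi o i' h
      · exact hi.elim
      · revert hi h
        refine Fin.cases (fun hi => ((not_isNonArticulation_zero _) hi).elim) (fun j _ => ?_) i
        rcases o with _ | c'
        · intro h
          exact (stepAtom_args_succ_ne_root h.symm).elim
        · refine Fin.cases (fun h => (stepAtom_args_succ_ne_root h.symm).elim) (fun j' h => ?_) i'
          obtain ⟨rfl, rfl⟩ := stdVar_some_inj (j := j') (j' := j) h
          exact ⟨rfl, rfl⟩
    · intro i hi
      obtain ⟨o, ho⟩ := hmem _ (List.get_mem _ p.1)
      obtain rfl : i = (0 : Fin (k + 1)) := (Option.some_injective _ hi).symm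
      have key : ∀ (f : Fact (S.union (relAux m e k)) V) b, stepAtoms V R π ρs o = f →
          IsNonArticulation (Saux := relAux m e k) (fun _ => some (0 : Fin (k + 1))) f.rel b →
          stdVar V (k := k) (π, none) ≠ f.args b := by
        rintro f b rfl
        rcases o with _ | c
        · exact fun h => h.elim
        · refine Fin.cases (fun hi => ((not_isNonArticulation_zero _) hi).elim) (fun j _ => ?_) b
          exact stepAtom_args_succ_ne_root.symm
      exact key _ _ ho hp

theorem outRule_isTAM [Infinite V] (ρ : (relAux m e k).Rel) : (outRule S V ρ).IsTAM := by
  refine ⟨TreeLike.isAcyclic ?_, ?_⟩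
  · intro f hf
    obtain rfl := List.mem_singleton.1 hf
    obtain ⟨κ, hκ⟩ := exists_stdVar_eq (V := V) (n := 0) (k := k)
      (fun x => some ((x.2.map Fin.succ).getD (0 : Fin (k + 1))))
    refine ⟨κ, ?_, fun g hg hne => (hne (List.mem_singleton.1 hg)).elim⟩
    exact Fin.cases (hκ _) fun j => hκ _
  · intro p hp
    refine ⟨Rule.body_varAt_injective_of_map _ [()] (List.nodup_singleton _)
      (fun _ => stepAtom V (n := 0) none (fun _ => ρ) none) rfl ?_ p hp, fun i hi => hi.elim⟩
    intro a i hi b i' h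
    revert hi h
    refine Fin.cases (fun hi => ((not_isNonArticulation_zero _) hi).elim) (fun j _ => ?_) i
    refine Fin.cases (fun h => (stepAtom_args_succ_ne_root h.symm).elim) (fun j' h => ?_) i'
    obtain ⟨-, rfl⟩ := stdVar_some_inj (j := j') (j' := j) h
    exact ⟨rfl, rfl⟩

/-- The structure on a target instance, in which the auxiliary relations are interpreted by their
names, and the output relation holds of all tuples but the distinguished one. -/
def targetModel (d : Fin m → PointedInst S V k) (val : Fin e → V) (l : Fin m) :
    Set (Fact ((singleOut k).union (relAux m e k)) V) :=
  fun
  | ⟨Sum.inl _, y⟩ => (y : Fin k → V) ≠ (d l).pt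
  | ⟨Sum.inr ρ, y⟩ => ∃ u : Fin (k + 1) → Fin e, (l, u) ∈ ρ ∧ (y : Fin (k + 1) → V) = val ∘ u

/-- The rule holds in all the structures on the target instances. -/
def Rule.SoundFor (d : Fin m → PointedInst S V k) (val : Fin e → V)
    (r : Rule S (singleOut k) (relAux m e k) V) : Prop :=
  ∀ l, r.Sound (d l).facts (targetModel d val l)

/-- The canonical TAM program for a finite set of target instances. -/
noncomputable def canonicalProgram [Infinite V] (d : Fin m → PointedInst S V k)
    (val : Fin e → V) : Program S V where
  out := singleOut k
  aux := relAux m e k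
  rules := {r | r.SoundFor d val ∧
    r ∈ Set.range (initRule V) ∪ Set.range (stepRule V) ∪ Set.range (outRule S V) ∪
      ⋃ hk : k = 0, Set.range (nullaryRule V hk)}
  finite := by
    have := S.finite
    have h1 : ∀ hk : k = 0, (Set.range
        (nullaryRule (S := S) (m := m) (e := e) V hk)).Finite := by
      intro hk
      have : Finite {R : S.Rel // S.arity R = 0} := inferInstance
      exact Set.finite_range _
    refine Set.Finite.subset ?_ fun r hr => hr.2
    exact (((Set.finite_range _).union (Set.finite_range _)).union (Set.finite_range _)).union
      (Set.finite_iUnion h1)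

theorem canonicalProgram_isTAM [Infinite V] (d : Fin m → PointedInst S V k) (val : Fin e → V) :
    (canonicalProgram d val).IsTAM := by
  have key : ∀ r ∈ (canonicalProgram d val).rules,
      Rule.IsTAM (r : Rule S (singleOut k) (relAux m e k) V) := by
    rintro r ⟨-, ((⟨p, rfl⟩ | ⟨p, rfl⟩) | ⟨p, rfl⟩) | hr⟩
    · exact initRule_isTAM p
    · exact stepRule_isTAM p
    · exact outRule_isTAM p
    · obtain ⟨hk, p, rfl⟩ := Set.mem_iUnion.1 hr
      exact nullaryRule_isTAM hk p
  exact ⟨fun r hr => (key r hr).1, fun _ => some (0 : Fin (k + 1)), fun r hr => (key r hr).2⟩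

/-- A homomorphism to a target would carry the derived output fact into `targetModel`, which is
closed under the rules and omits precisely the distinguished tuple. -/
theorem canonicalProgram_sound [Infinite V] (d : Fin m → PointedInst S V k) (val : Fin e → V)
    {A : PointedInst S V k}
    (hA : (⟨Sum.inl (), A.pt⟩ : Fact ((singleOut k).union (relAux m e k)) V) ∈
      (canonicalProgram d val).Holds A.facts) (l : Fin m) : ¬ A.HomTo (d l) := by
  rintro ⟨h, h1, h2⟩
  have := Program.Holds.map h1 hA (targetModel d val l) fun r hr => hr.1 l
  exact this (funext h2)

end Construction

/-! ### Derivability of the exact image relations on acyclic instances. -/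

section Completeness

variable {S : Schema} {V : Type u} [Infinite V] {k m e : ℕ}

/-- The relations of the images of the tuple `(v, z)` under homomorphisms from the facts `s` to the
target instances. -/
def homRel (d : Fin m → PointedInst S V k) (val : Fin e → V) (s : Finset (Fact S V)) (v : V)
    (z : Fin k → V) : (relAux m e k).Rel :=
  {x | ∃ h : V → Fin e, (∀ f ∈ s, f.map (val ∘ h) ∈ (d x.1).facts) ∧
    x.2 = h ∘ (Fin.cons v z : Fin (k + 1) → V)}

theorem initRule_soundFor (d : Fin m → PointedInst S V k) (val : Fin e → V)
    (hval : ∀ l, (d l).adom ⊆ Set.range val) (R : S.Rel) (i : Fin (S.arity R)) (v : V) :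
    (initRule V ⟨R, i, homRel d val ∅ v fun _ => v⟩).SoundFor d val := by
  intro l g hg
  have h1 := hg _ (List.mem_singleton_self _)
  obtain ⟨a, ha⟩ := hval l ⟨_, h1, i, rfl⟩
  refine ⟨fun _ => a, ⟨fun _ => a, by simp, rfl⟩, funext fun _ => ha.symm⟩

/-- One decomposition at `f`: if the image relation of each component is derived, so is that of `s`.
The step rule needed is valid in the targets because homomorphisms on the components that agree with
the image of `f` at the roots can be glued. -/
theorem step_mem (d : Fin m → PointedInst S V k) (val : Fin e → V)
    {I : Set (Fact S V)} {M : Set (Fact ((singleOut k).union (relAux m e k)) V)}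
    (hM : ∀ r ∈ (canonicalProgram d val).rules, r.Sound I M)
    (f : Fact S V) (hf : f ∈ I) (s : Finset (Fact S V))
    (κ : V → Option (Fin (S.arity f.rel))) (π : Option (Fin (S.arity f.rel)))
    (t : Option (Fin (S.arity f.rel)) → Finset (Fact S V))
    (w : Option (Fin (S.arity f.rel)) → V) (hw : ∀ c, w (c.or π) = w c)
    (hwf : ∀ i, w (some i) = f.args i) (hκ : ∀ i, κ (f.args i) = some i) (hκw : κ (w none) = π)
    (ht : ∀ g ∈ s, g ≠ f → ∃ c, g ∈ t c ∧ ∀ a, κ (g.args a) = c)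
    (z : Fin k → V) (zs : Option (Fin (S.arity f.rel)) → Fin k → V)
    (hz : ∀ j, zs (κ (z j)) j = z j)
    (hmem : ∀ c, (⟨Sum.inr (homRel d val (t c) (w c) (zs c)),
      (Fin.cons (w c) (zs c) : Fin (k + 1) → V)⟩ :
        Fact ((singleOut k).union (relAux m e k)) V) ∈ M) :
    (⟨Sum.inr (homRel d val s (w none) z), (Fin.cons (w none) z : Fin (k + 1) → V)⟩ :
        Fact ((singleOut k).union (relAux m e k)) V) ∈ M := by
  let r : Rule S (singleOut k) (relAux m e k) V := stepRule V ⟨f.rel, π, fun j => κ (z j),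
    fun c => homRel d val (t c) (w c) (zs c), homRel d val s (w none) z⟩
  have hrmem : ∀ g ∈ r.body, ∃ o, stepAtoms V f.rel π
      (fun c => homRel d val (t c) (w c) (zs c)) o = g := by
    intro g hg
    obtain ⟨o, -, rfl⟩ := List.mem_map.1 hg
    exact ⟨o, rfl⟩
  have hmemr : ∀ o, stepAtoms V f.rel π
      (fun c => homRel d val (t c) (w c) (zs c)) o ∈ r.body := fun o =>
    List.mem_map.2 ⟨o, Finset.mem_toList.2 (Finset.mem_univ _), rfl⟩
  have hr : r ∈ (canonicalProgram d val).rules := by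
    refine ⟨?_, Or.inl (Or.inl (Or.inr ⟨_, rfl⟩))⟩
    intro l g hg
    have hin : (⟨f.rel, fun i => g (stdVar V (k := k) (some i, none))⟩ : Fact S V) ∈ (d l).facts :=
      hg _ (hmemr none)
    have hcomp : ∀ c, ∃ h : V → Fin e, (∀ f ∈ t c, f.map (val ∘ h) ∈ (d l).facts) ∧
        val (h (w c)) = g (stdVar V (k := k) (c.or π, none)) ∧
        ∀ j, val (h (zs c j)) = g (stdVar V (c, some j)) := by
      intro c
      obtain ⟨u, ⟨h, hh1, hh2⟩, hu⟩ := hg _ (hmemr (some c))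
      have hu' : ∀ i : Fin (k + 1), g ((Fin.cons (stdVar V (k := k) (c.or π, none))
          fun j => stdVar V (c, some j) : Fin (k + 1) → V) i) =
          val (h ((Fin.cons (w c) (zs c) : Fin (k + 1) → V) i)) := by
        intro i
        have h3 := congrFun hu i
        have h4 := congrFun hh2 i
        exact h3.trans (congrArg val h4)
      exact ⟨h, hh1, (hu' 0).symm, fun j => (hu' j.succ).symm⟩
    choose h hh1 hh2 hh3 using hcomp
    -- Each element follows the homomorphism of the component given by its colour.
    let H : V → Fin e := fun x => h (κ x) x
    have hH : ∀ (g : Fact S V) c, (∀ a, κ (g.args a) = c) →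
        g.map (val ∘ H) = g.map (val ∘ h c) := by
      intro g c hc
      refine Fact.map_congr ?_
      rintro v ⟨a, rfl⟩
      simp only [Function.comp_apply, H, hc]
    refine ⟨H ∘ (Fin.cons (w none) z : Fin (k + 1) → V), ⟨H, fun g' hg' => ?_, rfl⟩, ?_⟩
    · by_cases hgf : g' = f
      · subst hgf
        have : g'.map (val ∘ H) = ⟨g'.rel, fun i => g (stdVar V (k := k) (some i, none))⟩ := by
          refine congrArg (Fact.mk g'.rel) (funext fun i => ?_)
          change val (h (κ (g'.args i)) (g'.args i)) = _
          rw [hκ, ← hwf, hh2]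
          rfl
        change g'.map (val ∘ H) ∈ (d l).facts
        rw [this]
        exact hin
      · obtain ⟨c, hc1, hc2⟩ := ht g' hg' hgf
        change g'.map (val ∘ H) ∈ (d l).facts
        rw [hH g' c hc2]
        exact hh1 c g' hc1
    · refine funext (Fin.cases ?_ fun j => ?_)
      · change g (stdVar V (k := k) (π, none)) = val (h (κ (w none)) (w none))
        -- The root `w none` has colour `π`, so `H` uses the homomorphism of component `π` there,
        -- whose root variable is also that of the head.
        have hππ : π.or π = π := by cases π <;> rfl
        have h0 := hw none
        rw [hκw, ← h0]
        have h1 := hh2 π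
        rw [hππ] at h1
        exact h1.symm
      · change g (stdVar V (κ (z j), some j)) = val (h (κ (z j)) (z j))
        rw [← hh3, hz]
  obtain ⟨g, hg⟩ := exists_stdVar_eq (V := V) (n := S.arity f.rel) (k := k)
    (fun x => (x.2.map (zs x.1)).getD (w x.1))
  have hgz : ∀ c j, g (stdVar V (c, some j)) = zs c j := fun c j => hg (c, some j)
  have hgw : ∀ c, g (stdVar V (k := k) (c, none)) = w c := fun c => hg (c, none)
  have hfin := hM r hr g (by
    intro f' hf'
    obtain ⟨o, rfl⟩ := hrmem f' hf'
    rcases o with _ | c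
    · have : (⟨f.rel, fun i => g (stdVar V (k := k) (some i, none))⟩ : Fact S V) = f :=
        congrArg (Fact.mk f.rel) (funext fun i => (hgw _).trans (hwf i))
      change (⟨f.rel, fun i => g (stdVar V (k := k) (some i, none))⟩ : Fact S V) ∈ I
      rw [this]
      exact hf
    · have h1 : (g ∘ (Fin.cons (stdVar V (k := k) (c.or π, none))
          fun j => stdVar V (c, some j) : Fin (k + 1) → V)) =
          (Fin.cons (w c) (zs c) : Fin (k + 1) → V) :=
        funext (Fin.cases ((hgw _).trans (hw c)) fun j => hgz c j)
      have h2 := hmem c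
      rw [← h1] at h2
      exact h2)
  have h1 : (g ∘ (Fin.cons (stdVar V (k := k) (π, none))
      fun j => stdVar V (κ (z j), some j) : Fin (k + 1) → V)) =
      (Fin.cons (w none) z : Fin (k + 1) → V) :=
    funext (Fin.cases ((hgw _).trans (hw none)) fun j => (hgz _ j).trans (hz j))
  rw [← h1]
  exact hfin

/-- Strong induction on `s`: a fact, chosen to contain the root `v` if possible, is removed, and
each remaining part is rooted at an argument of that fact or, for the colour `none`, at `v`. -/
theorem homRel_mem (d : Fin m → PointedInst S V k) (val : Fin e → V)
    (hval : ∀ l, (d l).adom ⊆ Set.range val)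
    {I : Inst S V} (hI : TreeLike I.facts)
    {M : Set (Fact ((singleOut k).union (relAux m e k)) V)}
    (hM : ∀ r ∈ (canonicalProgram d val).rules, r.Sound I.facts M)
    (s : Finset (Fact S V)) (hs : (s : Set (Fact S V)) ⊆ I.facts) (v : V) (hv : v ∈ I.adom)
    (z : Fin k → V) (hz : ∀ j, z j = v ∨ ∃ f ∈ s, z j ∈ Set.range f.args) :
    (⟨Sum.inr (homRel d val s v z), (Fin.cons v z : Fin (k + 1) → V)⟩ :
        Fact ((singleOut k).union (relAux m e k)) V) ∈ M := by
  classical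
  induction s using Finset.strongInduction generalizing v z with
  | H s ih =>
  rcases s.eq_empty_or_nonempty with rfl | hne
  · obtain rfl : z = fun _ => v := by
      funext j
      simpa using hz j
    obtain ⟨f, hf, i, rfl⟩ := hv
    obtain ⟨g, hg⟩ := exists_stdVar_eq (V := V) (n := S.arity f.rel) (k := k)
      (fun x => (x.1.map f.args).getD (f.args i))
    have h1 := hM (initRule V ⟨f.rel, i, homRel d val ∅ (f.args i) fun _ => f.args i⟩)
      ⟨initRule_soundFor d val hval _ _ _, Or.inl (Or.inl (Or.inl ⟨_, rfl⟩))⟩ g (by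
        intro f' hf'
        obtain rfl := List.mem_singleton.1 hf'
        have : (⟨f.rel, fun i => g (stdVar V (k := k) (some i, none))⟩ : Fact S V) = f :=
          congrArg (Fact.mk f.rel) (funext fun i => hg (some i, none))
        change (⟨f.rel, fun i => g (stdVar V (k := k) (some i, none))⟩ : Fact S V) ∈ I.facts
        rw [this]
        exact hf)
    have h2 : (g ∘ fun _ : Fin (k + 1) => stdVar V (k := k) (some i, none)) =
        (Fin.cons (f.args i) fun _ => f.args i : Fin (k + 1) → V) :=
      funext (Fin.cases (hg (some i, none)) fun j => hg (some i, none))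
    rw [← h2]
    exact h1
  · obtain ⟨f, hf, κ, χ, π, hκv, hπ, hκ, hχ⟩ : ∃ f ∈ s,
        ∃ (κ : V → Option (Fin (S.arity f.rel))) (χ : Fact S V → Option (Fin (S.arity f.rel)))
          (π : Option (Fin (S.arity f.rel))), κ v = π ∧ (∀ i, π = some i → f.args i = v) ∧
          (∀ i, κ (f.args i) = some i) ∧ ∀ g ∈ s, g ≠ f → ∀ a, κ (g.args a) = χ g := by
      by_cases hvs : ∃ f ∈ s, v ∈ Set.range f.args
      · obtain ⟨f, hf, i, rfl⟩ := hvs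
        obtain ⟨κ, χ, hκ, hχ⟩ := hI.exists_coloring (hs hf)
        refine ⟨f, hf, κ, χ, some i, hκ i, ?_, hκ, fun g hg => hχ g (hs hg)⟩
        intro j hj
        rw [Option.some_injective _ hj]
      · obtain ⟨f, hf⟩ := hne
        obtain ⟨κ, χ, hκ, hχ⟩ := hI.exists_coloring (hs hf)
        -- As `v` lies in no fact of `s`, it may be recoloured `none`, making it the root of the
        -- remainder.
        have hup : ∀ g ∈ s, ∀ a, Function.update κ v none (g.args a) = κ (g.args a) := by
          intro g hg a
          refine Function.update_of_ne ?_ _ _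
          rintro rfl
          exact hvs ⟨g, hg, a, rfl⟩
        refine ⟨f, hf, Function.update κ v none, χ, none, Function.update_self _ _ _, by simp,
          fun i => (hup f hf i).trans (hκ i), fun g hg hgf a => (hup g hg a).trans ?_⟩
        exact hχ g (hs hg) hgf a
    let w : Option (Fin (S.arity f.rel)) → V := fun c => (c.map f.args).getD v
    have hw : ∀ c, w (c.or π) = w c := by
      rintro (_ | c)
      · rcases π with _ | i
        · rfl
        · exact hπ i rfl
      · rfl
    let t : Option (Fin (S.arity f.rel)) → Finset (Fact S V) :=
      fun c => s.filter fun g => g ≠ f ∧ χ g = c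
    -- Each part keeps the entries of `z` of its own colour; the other entries are padded with its
    -- root.
    let zs : Option (Fin (S.arity f.rel)) → Fin k → V :=
      fun c j => if κ (z j) = c then z j else w c
    refine step_mem d val hM f (hs hf) s κ π t w hw (fun i => rfl) hκ hκv ?_ z zs ?_ ?_
    · exact fun g hg hgf => ⟨χ g, Finset.mem_filter.2 ⟨hg, hgf, rfl⟩, hχ g hg hgf⟩
    · intro j
      simp [zs]
    · intro c
      have hss : t c ⊂ s := Finset.filter_ssubset.2 ⟨f, hf, by simp⟩
      refine ih (t c) hss (fun g hg => hs (hss.1 hg)) (w c) ?_ (zs c) ?_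
      · rcases c with _ | i
        · exact hv
        · exact ⟨f, hs hf, i, rfl⟩
      · intro j
        by_cases hc : κ (z j) = c
        · simp only [zs, if_pos hc]
          rcases hz j with hzj | ⟨g, hg, a, ha⟩
          · left
            rw [hzj] at hc ⊢
            -- If `z j = v`, then `c = π`, and the root of component `π` is `v` itself.
            rw [← hc, hκv, ← Option.none_or (o := π), hw]
            rfl
          · by_cases hgf : g = f
            · subst hgf
              left
              rw [← ha] at hc ⊢
              rw [← hc, hκ]
              rfl
            · right
              refine ⟨g, Finset.mem_filter.2 ⟨hg, hgf, ?_⟩, a, ha⟩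
              rw [← hχ g hg hgf a, ha, hc]
        · left
          simp only [zs, if_neg hc]

/-- For `s` all of `B`, a tuple of the image relation equal on its last `k` entries to the
distinguished tuple of a target would be a homomorphism. None exists, so `outRule` for this relation
is valid and fires. -/
theorem canonicalProgram_complete (d : Fin m → PointedInst S V k) (val : Fin e → V)
    (hval : ∀ l, (d l).adom ⊆ Set.range val) {B : PointedInst S V k} (hB : TreeLike B.facts)
    (hBd : ∀ l, ¬ B.HomTo (d l)) :
    (⟨Sum.inl (), B.pt⟩ : Fact ((singleOut k).union (relAux m e k)) V) ∈
      (canonicalProgram d val).Holds B.facts := by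
  classical
  intro M hM
  by_cases hne : ∃ v, v ∈ B.adom
  · obtain ⟨v, hv⟩ := hne
    let ρ := homRel d val B.finite.toFinset v B.pt
    have hρ := homRel_mem d val hval hB hM B.finite.toFinset (by simp) v hv B.pt (by
      intro j
      right
      obtain ⟨f, hf, hj⟩ := B.pt_mem j
      exact ⟨f, by simpa using hf, hj⟩)
    obtain ⟨g, hg⟩ := exists_stdVar_eq (V := V) (n := 0) (k := k)
      (fun x => (x.2.map B.pt).getD v)
    have hr : (outRule S V ρ).SoundFor d val := by
      intro l g' hg' heq
      obtain ⟨u, ⟨h, hh1, rfl⟩, hu⟩ := hg' _ (List.mem_singleton_self _)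
      refine hBd l ⟨val ∘ h, fun f hf => hh1 f (by simpa using hf), fun j => ?_⟩
      exact (congrFun hu (Fin.succ j)).symm.trans (congrFun heq j)
    have h1 := hM (outRule S V ρ) ⟨hr, Or.inl (Or.inr ⟨_, rfl⟩)⟩ g (by
      intro f' hf'
      obtain rfl := List.mem_singleton.1 hf'
      have h2 : (g ∘ (Fin.cons (stdVar V (n := 0) (k := k) (none, none))
          fun j => stdVar V (none, some j) : Fin (k + 1) → V)) =
          (Fin.cons v B.pt : Fin (k + 1) → V) :=
        funext (Fin.cases (hg (none, none)) fun j => hg (none, some j))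
      rw [← h2] at hρ
      exact hρ)
    have h2 : (g ∘ fun j => stdVar V (n := 0) (none, some j)) = B.pt :=
      funext fun j => hg (none, some j)
    rw [← h2]
    exact h1
  -- With an empty active domain there is no root to start from: `k = 0` and all facts are nullary,
  -- and a single `nullaryRule` listing them suffices.
  · have hk : k = 0 := by
      by_contra hk
      exact hne ⟨_, B.pt_mem ⟨0, Nat.pos_of_ne_zero hk⟩⟩
    subst hk
    have hnull : ∀ f ∈ B.facts, S.arity f.rel = 0 := by
      intro f hf
      by_contra h
      exact hne ⟨_, f, hf, ⟨0, Nat.pos_of_ne_zero h⟩, rfl⟩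
    have := S.finite
    have := Fintype.ofFinite {R : S.Rel // S.arity R = 0}
    let N : Finset {R : S.Rel // S.arity R = 0} :=
      Finset.univ.filter fun R => ∃ f ∈ B.facts, f.rel = R.1
    let r : Rule S (singleOut 0) (relAux m e 0) V := nullaryRule V rfl N
    have hnullmap : ∀ (f f' : Fact S V), S.arity f.rel = 0 → f.rel = f'.rel → f = f' := by
      rintro ⟨R, x⟩ ⟨R', x'⟩ h h'
      obtain rfl : R = R' := h'
      exact congrArg (Fact.mk R) (funext fun i => (Fin.cast h i).elim0)
    have hr : r.SoundFor d val := by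
      intro l g hg heq
      refine hBd l ⟨id, fun f hf => ?_, fun j => j.elim0⟩
      have hmem : (⟨f.rel, hnull f hf⟩ : {R : S.Rel // S.arity R = 0}) ∈ N :=
        Finset.mem_filter.2 ⟨Finset.mem_univ _, f, hf, rfl⟩
      have h1 := hg _ (List.mem_map.2 ⟨_, Finset.mem_toList.2 hmem, rfl⟩)
      have h2 : (⟨f.rel, g ∘ fun i => (Fin.cast (hnull f hf) i).elim0⟩ : Fact S V) ∈
        (d l).facts := h1
      have h3 : f.map id = ⟨f.rel, g ∘ fun i => (Fin.cast (hnull f hf) i).elim0⟩ :=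
        hnullmap _ _ (hnull f hf) rfl
      rw [h3]
      exact h2
    have h1 := hM r ⟨hr, Or.inr (Set.mem_iUnion.2 ⟨rfl, _, rfl⟩)⟩ id (by
      intro f' hf'
      obtain ⟨R, hR, rfl⟩ := List.mem_map.1 hf'
      obtain ⟨f, hf, hfR⟩ := (Finset.mem_filter.1 (Finset.mem_toList.1 hR)).2
      have h2 := hnullmap f ⟨R.1, id ∘ fun i => (Fin.cast R.2 i).elim0⟩ (hnull f hf) hfR
      rw [h2] at hf
      exact hf)
    have h2 : (id ∘ fun j : Fin 0 => (j.cast rfl).elim0) = B.pt := funext fun j => j.elim0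
    rw [← h2]
    exact h1

/-- A set of acyclic instances with a finite set of duals is given by the unfoldings of a TAM
program. -/
theorem exists_program_of_finite_dual {F D : Set (PointedInst S V k)}
    (hF : ∀ A ∈ F, A.IsAcyclic) (hD : D.Finite) (hFD : up F = (down D)ᶜ) :
    ∃ P : Program S V, P.IsTAM ∧ ∃ (R : P.out.Rel) (hk : P.out.arity R = k),
      up F = up (hk ▸ P.unfoldings R) := by
  obtain ⟨m, ⟨eD⟩⟩ := @Finite.exists_equiv_fin D hD.to_subtype
  let d : Fin m → PointedInst S V k := fun l => (eD.symm l).1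
  have hE : (⋃ l, (d l).adom).Finite := by
    refine Set.finite_iUnion fun l => ?_
    have : (d l).adom = ⋃ f ∈ (d l).facts, Set.range f.args := by
      ext v
      simp [Inst.adom]
    rw [this]
    exact (d l).finite.biUnion fun f _ => Set.finite_range _
  obtain ⟨e, ⟨eE⟩⟩ := @Finite.exists_equiv_fin _ hE.to_subtype
  let val : Fin e → V := fun a => (eE.symm a).1
  have hval : ∀ l, (d l).adom ⊆ Set.range val := by
    intro l v hv
    exact ⟨eE ⟨v, Set.mem_iUnion.2 ⟨l, hv⟩⟩, by simp [val]⟩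
  refine ⟨canonicalProgram d val, canonicalProgram_isTAM d val, (), rfl, ?_⟩
  ext A
  constructor
  · rintro ⟨B, hB, hBA⟩
    have hBup : B ∈ up F := ⟨B, hB, id, fun f hf => hf, fun _ => rfl⟩
    have hBD : ∀ l, ¬ B.HomTo (d l) := by
      intro l hl
      rw [hFD] at hBup
      exact hBup ⟨d l, (eD.symm l).2, hl⟩
    have := canonicalProgram_complete d val hval (hF B hB).treeLike hBD
    exact up_closed (((canonicalProgram d val).mem_up_unfoldings_iff () B).2 this) hBA
  · intro hA
    have := canonicalProgram_sound d val (((canonicalProgram d val).mem_up_unfoldings_iff () A).1 hA)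
    rw [hFD]
    rintro ⟨C, hC, hAC⟩
    refine this (eD ⟨C, hC⟩) ?_
    simpa [d] using hAC

end Completeness
end TAMDatalog

theorem mainTheorem7 {V : Type*} [Infinite V] (S : TAMDatalog.Schema) (k : ℕ)
    (F : Set (TAMDatalog.PointedInst S V k)) (hF : ∀ A ∈ F, A.IsAcyclic) :
    (∃ D : Set (TAMDatalog.PointedInst S V k), D.Finite ∧ TAMDatalog.IsHomDuality F D) ↔
      (∃ P : TAMDatalog.Program S V, P.IsTAM ∧
        ∃ (R : P.out.Rel) (hk : P.out.arity R = k),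
          TAMDatalog.up F = TAMDatalog.up (hk ▸ P.unfoldings R)) := by
  constructor
  · rintro ⟨D, hD, hFD⟩
    exact TAMDatalog.exists_program_of_finite_dual hF hD hFD
  · rintro ⟨P, hP, R, rfl, hup⟩
    obtain ⟨D, hD, hFD⟩ := P.exists_finite_dual hP R
    exact ⟨D, hD, hup.trans hFD⟩
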